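/- Let $\mathbb T=(\mathbb R/2\pi\mathbb Z)^3$ be the torus, i.e. the box $[0,2\pi]^3$ with periodic boundary conditions, and let $\alpha>0$. Let $$H=\Big\{v\in (L^2(\mathbb T))^3:\ \nabla\cdot v=0,\ \int_{\mathbb T}v\,dx=0\Big\},\qquad V=H\cap (H^1(\mathbb T))^3,$$ where the divergence is understood in the sense of (periodic) distributions; $H$ carries the norm of $(L^2(\mathbb T))^3$ and $V$ that of $(H^1(\mathbb T))^3$. Let $V'$ be the dual of $V$, and regard $H\simeq H'\subset V'$ through $h\mapsto\big(w\mapsto\int_{\mathbb T}\langle h,w\rangle\,dx\big)$. Consider the inviscid Leray-$\alpha$ model $$\frac{\partial v}{\partial t}+(u\cdot\nabla)v+\nabla p=0,\qquad v=(1-\alpha\Delta)u,\qquad \nabla\cdot v=0 .$$ **Theorem.** Let $v_0\in H$ and $T>0$. Then this system has a weak solution $v$ on $[0,T]$ with initial velocity $v_0$: there is $$v\in L^\infty([0,T];H)\cap C([0,T];V'),$$ with $v(t)\in H$ for every $t\in[0,T]$, such that, with $u(t)=(1-\alpha\Delta)^{-1}v(t)$ (which again lies in $H$; the equation holds in the sense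 of periodic distributions), for every divergence free $\varphi:\mathbb R^3\to\mathbb R^3$ of class $C^1$, $2\pi$-periodic in each coordinate, the function $s\mapsto\int_{\mathbb T}\langle (u(s,x)\cdot\nabla)\varphi(x),v(s,x)\rangle\,dx$ is integrable on $[0,T]$ and $$\int_{\mathbb T}\langle v(t,x),\varphi(x)\rangle\,dx-\int_0^t\int_{\mathbb T}\langle (u(s,x)\cdot\nabla)\varphi(x),v(s,x)\rangle\,dx\,ds=\int_{\mathbb T}\langle v_0(x),\varphi(x)\rangle\,dx\qquad\text{for every } t\in[0,T].$$ -/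

import Mathlib

open MeasureTheory Set
open scoped ContDiff RealInnerProductSpace Gradient

noncomputable section

namespace LerayAlpha

/-- Three-dimensional Euclidean space. -/
abbrev E3 : Type := EuclideanSpace ℝ (Fin 3)

/-- The `j`-th standard basis vector. -/
abbrev e (j : Fin 3) : E3 := EuclideanSpace.single j (1 : ℝ)

/-- The period box `[0, 2π]³`. -/
def box : Set E3 := {x | ∀ i, x i ∈ Icc (0 : ℝ) (2 * Real.pi)}

/-- Functions on the torus `(ℝ/2πℤ)³`, seen as functions on `ℝ³` with period `2π` in each
coordinate. -/
def IsPeriodic {F : Type*} (f : E3 → F) : Prop :=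
  ∀ (j : Fin 3) (x : E3), f (x + (2 * Real.pi) • e j) = f x

/-- Scalar smooth periodic functions: the test functions of distribution theory on the torus. -/
structure IsSmoothPeriodic (q : E3 → ℝ) : Prop where
  smooth : ContDiff ℝ ∞ q
  periodic : IsPeriodic q

/-- The space `(L²(𝕋))³` of square integrable vector fields on the torus. -/
abbrev L2 : Type := Lp E3 2 (volume.restrict box)

lemma isCompact_box : IsCompact box := by
  have h : box = (EuclideanSpace.equiv (Fin 3) ℝ).toHomeomorph ⁻¹'
      (Set.univ.pi fun _ => Icc (0 : ℝ) (2 * Real.pi)) := by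
    ext x
    exact ⟨fun h i _ => h i, fun h i => h i trivial⟩
  rw [h]
  exact (Homeomorph.isCompact_preimage _).2 (isCompact_univ_pi fun _ => isCompact_Icc)

lemma volume_box_lt_top : volume box < ⊤ := isCompact_box.measure_lt_top

instance : IsFiniteMeasure (volume.restrict box) :=
  ⟨by simpa using volume_box_lt_top⟩

lemma memLp_of_continuous {F : Type*} [NormedAddCommGroup F] [SecondCountableTopology F]
    {f : E3 → F} (hf : Continuous f) : MemLp f 2 (volume.restrict box) := by
  obtain ⟨C, hC⟩ := isCompact_box.exists_bound_of_continuousOn hf.continuousOn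
  refine MemLp.of_bound hf.aestronglyMeasurable C ?_
  exact (ae_restrict_iff' isCompact_box.measurableSet).2 (Filter.Eventually.of_forall hC)

lemma integrable_field (v : L2) : Integrable v (volume.restrict box) :=
  (Lp.memLp v).integrable (by norm_num)

lemma integrable_smul_field {f : E3 → ℝ} (hf : Continuous f) (v : L2) :
    Integrable (fun x => f x • v x) (volume.restrict box) :=
  memLp_one_iff_integrable.1 ((Lp.memLp v).smul (memLp_of_continuous hf))

lemma integrable_inner_field {w : E3 → E3} (hw : Continuous w) (v : L2) :
    Integrable (fun x => ⟪v x, w x⟫) (volume.restrict box) :=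
  (L2.integrable_inner v (memLp_of_continuous hw).toLp).congr
    (by filter_upwards [(memLp_of_continuous hw).coeFn_toLp] with x hx; rw [hx])

lemma IsSmoothPeriodic.continuous_fderiv_apply {q : E3 → ℝ} (hq : IsSmoothPeriodic q) (y : E3) :
    Continuous fun x => fderiv ℝ q x y :=
  (hq.smooth.continuous_fderiv (by simp)).clm_apply continuous_const

lemma IsSmoothPeriodic.continuous_gradient {q : E3 → ℝ} (hq : IsSmoothPeriodic q) :
    Continuous (∇ q) :=
  (InnerProductSpace.toDual ℝ E3).symm.continuous.comp (hq.smooth.continuous_fderiv (by simp))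

/-- The energy space `H`: square integrable fields on the torus with zero mean and zero divergence.
The divergence is taken in the sense of distributions on the torus, i.e. against periodic test
functions, which also encodes the periodicity of the normal component across the faces of the box.
The norm is the one of `L²`. -/
def H : Submodule ℝ L2 where
  carrier := {v | ∫ x in box, v x = 0 ∧
    ∀ q : E3 → ℝ, IsSmoothPeriodic q → ∫ x in box, ⟪v x, ∇ q x⟫ = 0}
  zero_mem' := by
    have h0 := Lp.coeFn_zero E3 2 (volume.restrict box)
    constructor
    · rw [integral_congr_ae h0]; simp
    · intro q _
      rw [integral_congr_ae (g := fun _ => (0 : ℝ)) (by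
        filter_upwards [h0] with x hx
        rw [hx]; simp)]
      simp
  add_mem' := by
    rintro v w ⟨hv, hv'⟩ ⟨hw, hw'⟩
    have h := Lp.coeFn_add v w
    constructor
    · rw [integral_congr_ae h]
      simp only [Pi.add_apply]
      rw [integral_add (integrable_field v) (integrable_field w), hv, hw, add_zero]
    · intro q hq
      rw [integral_congr_ae (g := fun x => ⟪v x, ∇ q x⟫ + ⟪w x, ∇ q x⟫) (by
        filter_upwards [h] with x hx
        rw [hx, Pi.add_apply, inner_add_left])]
      rw [integral_add (integrable_inner_field hq.continuous_gradient v)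
        (integrable_inner_field hq.continuous_gradient w), hv' q hq, hw' q hq, add_zero]
  smul_mem' := by
    rintro c v ⟨hv, hv'⟩
    have h := Lp.coeFn_smul c v
    constructor
    · rw [integral_congr_ae h]
      simp only [Pi.smul_apply]
      rw [integral_smul, hv, smul_zero]
    · intro q hq
      rw [integral_congr_ae (g := fun x => c * ⟪v x, ∇ q x⟫) (by
        filter_upwards [h] with x hx
        rw [hx, Pi.smul_apply, real_inner_smul_left])]
      rw [integral_const_mul, hv' q hq, mul_zero]

/-- `g` is the weak partial derivative `∂v/∂xʲ` of `v` on the torus. -/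
def IsWeakPartial (j : Fin 3) (v g : L2) : Prop :=
  ∀ q : E3 → ℝ, IsSmoothPeriodic q →
    ∫ x in box, fderiv ℝ q x (e j) • v x = -∫ x in box, q x • g x

lemma IsWeakPartial.zero (j : Fin 3) : IsWeakPartial j 0 0 := by
  intro q _
  have h0 := Lp.coeFn_zero E3 2 (volume.restrict box)
  rw [integral_congr_ae (g := fun _ => (0 : E3)) (by filter_upwards [h0] with x hx; rw [hx]; simp),
    integral_congr_ae (f := fun x => q x • (0 : L2) x) (g := fun _ => (0 : E3))
      (by filter_upwards [h0] with x hx; rw [hx]; simp)]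
  simp

lemma IsWeakPartial.add {j : Fin 3} {v w g k : L2} (hv : IsWeakPartial j v g)
    (hw : IsWeakPartial j w k) : IsWeakPartial j (v + w) (g + k) := by
  intro q hq
  rw [integral_congr_ae (g := fun x => fderiv ℝ q x (e j) • v x + fderiv ℝ q x (e j) • w x)
      (by filter_upwards [Lp.coeFn_add v w] with x hx; rw [hx, Pi.add_apply, smul_add]),
    integral_congr_ae (f := fun x => q x • (g + k) x) (g := fun x => q x • g x + q x • k x)
      (by filter_upwards [Lp.coeFn_add g k] with x hx; rw [hx, Pi.add_apply, smul_add]),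
    integral_add (integrable_smul_field (hq.continuous_fderiv_apply _) v)
      (integrable_smul_field (hq.continuous_fderiv_apply _) w),
    integral_add (integrable_smul_field hq.smooth.continuous g)
      (integrable_smul_field hq.smooth.continuous k), hv q hq, hw q hq, neg_add]

lemma IsWeakPartial.smul {j : Fin 3} {v g : L2} (c : ℝ) (hv : IsWeakPartial j v g) :
    IsWeakPartial j (c • v) (c • g) := by
  intro q hq
  rw [integral_congr_ae (g := fun x => c • fderiv ℝ q x (e j) • v x)
      (by filter_upwards [Lp.coeFn_smul c v] with x hx; rw [hx, Pi.smul_apply, smul_comm]),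
    integral_congr_ae (f := fun x => q x • (c • g) x) (g := fun x => c • q x • g x)
      (by filter_upwards [Lp.coeFn_smul c g] with x hx; rw [hx, Pi.smul_apply, smul_comm]),
    integral_smul, integral_smul, hv q hq, smul_neg]

/-- The space `V = H ∩ (H¹(𝕋))³`. A member is stored as the pair `(v, ∇v)` of a field `v ∈ H` and
its (unique) weak gradient, so that the norm is the `H¹` norm
`(‖v‖² + ∑ j, ‖∂v/∂xʲ‖²)^(1/2)`. -/
def V : Submodule ℝ (WithLp 2 (L2 × PiLp 2 fun _ : Fin 3 => L2)) where
  carrier := {w | w.fst ∈ H ∧ ∀ j, IsWeakPartial j w.fst (w.snd j)}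
  zero_mem' := ⟨H.zero_mem, fun j => IsWeakPartial.zero j⟩
  add_mem' := fun hv hw => ⟨H.add_mem hv.1 hw.1, fun j => (hv.2 j).add (hw.2 j)⟩
  smul_mem' := fun c _ hv => ⟨H.smul_mem c hv.1, fun j => (hv.2 j).smul c⟩

/-- The dual space `V'`, with the dual norm. -/
abbrev VDual : Type := StrongDual ℝ V

/-- The embedding `H ≃ H' ⊂ V'` of the Gelfand triple: `h ↦ (w ↦ ∫ ⟨h, w⟩ dx)`. -/
def toVDual (h : H) : VDual :=
  (innerSL ℝ (h : L2)).comp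
    ((WithLp.fstL 2 ℝ L2 (PiLp 2 fun _ : Fin 3 => L2)).comp V.subtypeL)

/-- `(1 - αΔ) u = v` on the torus, in the sense of distributions. For `α ≥ 0` there is, for each
`v`, exactly one such `u`, namely `u = (1 - αΔ)⁻¹ v`. -/
def IsFiltered (α : ℝ) (v u : L2) : Prop :=
  ∀ q : E3 → ℝ, IsSmoothPeriodic q →
    ∫ x in box, (q x - α * Laplacian.laplacian q x) • u x = ∫ x in box, q x • v x

/-- The test fields: periodic, divergence free and of class `C¹`. -/
structure IsTestField (φ : E3 → E3) : Prop where
  contDiff : ContDiff ℝ 1 φ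
  periodic : IsPeriodic φ
  div_free : ∀ x, ∑ j, fderiv ℝ φ x (e j) j = 0

/-- The trilinear term `∫ ⟨(u·∇)φ, v⟩ dx`. -/
def transport (u v : L2) (φ : E3 → E3) : ℝ :=
  ∫ x in box, ⟪fderiv ℝ φ x (u x), v x⟫

/-- `v`, with the filtered velocity `u = (1 - αΔ)⁻¹ v`, is a weak solution on `[0, T]` of the
inviscid Leray-α model with initial velocity `v₀`, in the class `L^∞([0,T]; H) ∩ C([0,T]; V')`.
The values of `v` and `u` outside `[0, T]` are irrelevant. -/
structure IsWeakSolution (α T : ℝ) (v₀ : H) (v u : ℝ → H) : Prop where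
  memLp_top : MemLp v ⊤ (volume.restrict (Icc 0 T))
  continuousOn : ContinuousOn (fun t => toVDual (v t)) (Icc 0 T)
  filtered : ∀ t ∈ Icc 0 T, IsFiltered α (v t) (u t)
  integrable : ∀ φ, IsTestField φ →
    IntegrableOn (fun s => transport (u s) (v s) φ) (Icc 0 T)
  weak_form : ∀ φ, IsTestField φ → ∀ t ∈ Icc 0 T,
    (∫ x in box, ⟪(v t : L2) x, φ x⟫) - ∫ s in (0 : ℝ)..t, transport (u s) (v s) φ
      = ∫ x in box, ⟪(v₀ : L2) x, φ x⟫

end LerayAlpha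

end

/-!
Weak solutions are constructed by a Galerkin method. It works in the real Hartley basis
`(2π)^(-3/2) (cos k·x + sin k·x)`, `k ∈ ℤ³`, of the torus, which diagonalizes the filter
`(1 - αΔ)⁻¹`, turns the divergence condition into orthogonality of the amplitude of index `k` to
`k`, and makes differentiation a multiplication combined with the reflection `k ↦ -k`. Completeness
of this basis is deduced from the density of trigonometric polynomials on Mathlib's torus
(`ae_eq_zero_of_forall_setIntegral_hart`).

The approximate problem is an ordinary differential equation `v' = B(v, v)` in `L²`, where `B` is
the projection of the nonlinearity onto divergence free trigonometric polynomials with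
frequencies at most `n` in each variable. Transport by a divergence free velocity is skew-symmetric
(`inner_galerkin_self`), so that `‖v‖` is conserved and the solution is global
(`exists_forall_hasDerivWithinAt_of_inner_eq_zero`).

Two consequences of the filter carry the limit `n → ∞`; both come from the summability over `ℤ³` of
`(1 + α|k|²)⁻²`. The filtered velocity `u` is bounded by a multiple of `‖v‖`
(`exists_bound_filtered`), hence the nonlinearities are bounded in `V'` uniformly in `n`
(`exists_bound_galerkin`): the approximations are equi-Lipschitz with values in `V'`, and by
Arzelà–Ascoli a subsequence converges, in each Fourier coefficient and at every time
(`exists_limit`). Moreover the filter turns weak convergence of `v` into strong convergence of `u`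
(`tendsto_multiplier_filterLeray`). The nonlinear term `∫ ⟨(u·∇)φ, v⟩` pairs the strongly convergent
`u` with the weakly convergent `v`, so it passes to the limit at every time
(`tendsto_inner_galerkin`), and dominated convergence gives the weak formulation.
-/

noncomputable section

namespace LerayAlpha

/-! ### Integration by parts on the torus -/

lemma box_eq_preimage : box = WithLp.ofLp ⁻¹' (Icc (0 : Fin 3 → ℝ) fun _ => 2 * Real.pi) := by
  ext x
  simp only [box, mem_ofPred_eq, mem_preimage, mem_Icc, Pi.le_def, Pi.zero_apply, forall_and]

lemma setIntegral_box {F : Type*} [NormedAddCommGroup F] [NormedSpace ℝ F] (f : E3 → F) :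
    ∫ x in box, f x
      = ∫ y in Icc (0 : Fin 3 → ℝ) fun _ => 2 * Real.pi, f (WithLp.toLp 2 y) := by
  rw [box_eq_preimage, ← (PiLp.volume_preserving_ofLp (Fin 3)).setIntegral_preimage_emb
    (MeasurableEquiv.toLp 2 (Fin 3 → ℝ)).symm.measurableEmbedding]

/-- The integral of a derivative over the torus vanishes: the opposite faces of the box contribute
equal boundary terms. -/
lemma setIntegral_box_fderiv_eq_zero {F : Type*} [NormedAddCommGroup F] [NormedSpace ℝ F]
    {g : E3 → F} (hg : ContDiff ℝ 1 g) (hp : IsPeriodic g) (j : Fin 3) :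
    ∫ x in box, fderiv ℝ g x (e j) = 0 := by
  let L : (Fin 3 → ℝ) →L[ℝ] E3 := ((EuclideanSpace.equiv (Fin 3) ℝ).symm : (Fin 3 → ℝ) →L[ℝ] E3)
  have hL : ∀ y, L y = WithLp.toLp 2 y := fun y => rfl
  rw [setIntegral_box]
  have hd : ∀ y, HasFDerivAt (fun y : Fin 3 → ℝ => g (WithLp.toLp 2 y))
      ((fderiv ℝ g (WithLp.toLp 2 y)).comp L) y := fun y =>
    ((hg.differentiable one_ne_zero).differentiableAt.hasFDerivAt (x := L y)).comp y L.hasFDerivAt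
  have hc : Continuous fun y : Fin 3 → ℝ => g (WithLp.toLp 2 y) := hg.continuous.comp L.continuous
  have hpt : ∀ y : Fin 3 → ℝ, ∑ i, (if i = j then (fderiv ℝ g (WithLp.toLp 2 y)).comp L
      else 0) (Pi.single i 1) = fderiv ℝ g (WithLp.toLp 2 y) (e j) := by
    intro y
    rw [Finset.sum_eq_single j (fun i _ hi => by simp [hi]) (by simp)]
    simp [hL]
  have hcont : Continuous fun y : Fin 3 → ℝ => fderiv ℝ g (WithLp.toLp 2 y) (e j) :=
    ((hg.continuous_fderiv one_ne_zero).comp L.continuous).clm_apply continuous_const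
  have key := integral_divergence_of_hasFDerivAt_off_countable' (E := F)
    (0 : Fin 3 → ℝ) (fun _ => 2 * Real.pi) (fun _ => by positivity)
    (fun i y => if i = j then g (WithLp.toLp 2 y) else 0)
    (fun i y => if i = j then (fderiv ℝ g (WithLp.toLp 2 y)).comp L else 0) ∅ (by simp)
    (fun i => by
      by_cases h : i = j
      · simpa [h] using hc.continuousOn
      · simpa [h] using continuousOn_const)
    (fun y _ i => by
      by_cases h : i = j
      · simpa [h] using hd y
      · simpa [h] using hasFDerivAt_const (0 : F) y)
    (by
      simp_rw [hpt]
      exact hcont.continuousOn.integrableOn_compact isCompact_Icc)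
  simp_rw [hpt] at key
  rw [key]
  refine Finset.sum_eq_zero fun i _ => ?_
  by_cases h : i = j
  · subst h
    rw [sub_eq_zero]
    refine integral_congr_ae (Filter.Eventually.of_forall fun y => ?_)
    simp only [if_true]
    rw [show g (WithLp.toLp 2 (i.insertNth ((0 : Fin 3 → ℝ) i) y)) = _ from
      (hp i (WithLp.toLp 2 (i.insertNth ((0 : Fin 3 → ℝ) i) y))).symm]
    congr 1
    ext l
    refine i.succAboveCases ?_ (fun l => ?_) l
    · simp
    · simp
  · simp [h]

lemma sum_smul_e (y : E3) : ∑ j, y j • e j = y := by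
  ext i
  simp [Finset.sum_apply, Pi.single_apply]

lemma setIntegral_box_fderiv_apply_eq_zero {F : Type*} [NormedAddCommGroup F] [NormedSpace ℝ F]
    {g : E3 → F} (hg : ContDiff ℝ 1 g) (hp : IsPeriodic g) (y : E3) :
    ∫ x in box, fderiv ℝ g x y = 0 := by
  have h : ∀ x, fderiv ℝ g x y = ∑ j, y j • fderiv ℝ g x (e j) := fun x => by
    conv_lhs => rw [← sum_smul_e y, map_sum]
    simp only [map_smul]
  simp_rw [h]
  rw [integral_finsetSum]
  · simp_rw [integral_smul, setIntegral_box_fderiv_eq_zero hg hp]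
    simp
  · exact fun j _ => (((hg.continuous_fderiv one_ne_zero).clm_apply
      continuous_const).continuousOn.integrableOn_compact isCompact_box).smul _

/-- Integration by parts on the torus, with a scalar factor and a vector valued one. -/
lemma setIntegral_box_fderiv_smul {F : Type*} [NormedAddCommGroup F] [NormedSpace ℝ F]
    {f : E3 → ℝ} {g : E3 → F} (hf : ContDiff ℝ 1 f) (hfp : IsPeriodic f)
    (hg : ContDiff ℝ 1 g) (hgp : IsPeriodic g) (y : E3) :
    ∫ x in box, fderiv ℝ f x y • g x = -∫ x in box, f x • fderiv ℝ g x y := by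
  have hcf := (hf.continuous_fderiv one_ne_zero).clm_apply (continuous_const (y := y))
  have hcg := (hg.continuous_fderiv one_ne_zero).clm_apply (continuous_const (y := y))
  have h := setIntegral_box_fderiv_apply_eq_zero (hf.smul hg)
    (fun j x => by simp only [Pi.smul_apply', hfp j x, hgp j x]) y
  have h2 : ∀ x, fderiv ℝ (f • g) x y
      = f x • fderiv ℝ g x y + fderiv ℝ f x y • g x := by
    intro x
    rw [fderiv_smul (hf.differentiable one_ne_zero).differentiableAt
      (hg.differentiable one_ne_zero).differentiableAt]
    simp
  rw [setIntegral_congr_fun isCompact_box.measurableSet fun x _ => h2 x,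
    integral_add, add_comm] at h
  · exact eq_neg_of_add_eq_zero_left h
  · exact (hf.continuous.smul hcg).continuousOn.integrableOn_compact isCompact_box
  · exact (hcf.smul hg.continuous).continuousOn.integrableOn_compact isCompact_box

/-! ### The Hartley functions -/

/-- The wave vector `k ∈ ℤ³`, seen in `ℝ³`. -/
def freq (k : Fin 3 → ℤ) : E3 := WithLp.toLp 2 fun i => (k i : ℝ)

@[simp] lemma freq_apply (k : Fin 3 → ℤ) (i : Fin 3) : freq k i = k i := rfl

lemma freq_neg (k : Fin 3 → ℤ) : freq (-k) = -freq k := by ext i; simp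

lemma freq_add (k l : Fin 3 → ℤ) : freq (k + l) = freq k + freq l := by ext i; simp

lemma freq_sub (k l : Fin 3 → ℤ) : freq (k - l) = freq k - freq l := by ext i; simp

@[simp] lemma inner_freq_e (k : Fin 3 → ℤ) (j : Fin 3) : ⟪freq k, e j⟫ = k j := by
  simp [EuclideanSpace.inner_single_right]

/-- The normalizing constant `(2π)^(-3/2)`. -/
def normConst : ℝ := (√((2 * Real.pi) ^ 3))⁻¹

lemma normConst_pos : 0 < normConst := by unfold normConst; positivity

lemma normConst_mul_self : normConst * normConst * (2 * Real.pi) ^ 3 = 1 := by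
  have h : (0 : ℝ) < (2 * Real.pi) ^ 3 := by positivity
  unfold normConst
  rw [← mul_inv, Real.mul_self_sqrt h.le, inv_mul_cancel₀ h.ne']

/-- The Hartley function `(2π)^(-3/2) (cos k·x + sin k·x)`. These functions form a real orthonormal
basis of the scalar `L²` space of the torus, indexed by all of `ℤ³`. -/
def hart (k : Fin 3 → ℤ) (x : E3) : ℝ :=
  normConst * (Real.cos ⟪freq k, x⟫ + Real.sin ⟪freq k, x⟫)

lemma hart_zero (x : E3) : hart 0 x = normConst := by
  have : freq 0 = 0 := by ext i; simp
  simp [hart, this]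

lemma contDiff_hart (k : Fin 3 → ℤ) {n : WithTop ℕ∞} : ContDiff ℝ n (hart k) := by
  have h : ContDiff ℝ n fun x : E3 => ⟪freq k, x⟫ := contDiff_const.inner ℝ contDiff_id
  exact contDiff_const.mul ((Real.contDiff_cos.comp h).add (Real.contDiff_sin.comp h))

lemma continuous_hart (k : Fin 3 → ℤ) : Continuous (hart k) := (contDiff_hart k (n := 0)).continuous

lemma isPeriodic_hart (k : Fin 3 → ℤ) : IsPeriodic (hart k) := by
  intro j x
  have : ⟪freq k, x + (2 * Real.pi) • e j⟫ = ⟪freq k, x⟫ + k j * (2 * Real.pi) := by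
    rw [inner_add_right, real_inner_smul_right, inner_freq_e]; ring
  simp only [hart, this, Real.cos_add_int_mul_two_pi, Real.sin_add_int_mul_two_pi]

lemma isSmoothPeriodic_hart (k : Fin 3 → ℤ) : IsSmoothPeriodic (hart k) :=
  ⟨contDiff_hart k, isPeriodic_hart k⟩

/-- Differentiation maps a Hartley function to a multiple of its reflection. -/
lemma hasFDerivAt_hart (k : Fin 3 → ℤ) (x : E3) :
    HasFDerivAt (hart k) (hart (-k) x • innerSL ℝ (freq k)) x := by
  have h : HasFDerivAt (fun x : E3 => ⟪freq k, x⟫) (innerSL ℝ (freq k)) x :=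
    (innerSL ℝ (freq k)).hasFDerivAt
  refine ((h.cos.add h.sin).const_mul normConst).congr_fderiv ?_
  ext1 y
  simp only [hart, freq_neg, inner_neg_left, Real.cos_neg, Real.sin_neg,
    smul_apply, add_apply, smul_eq_mul]
  ring

lemma fderiv_hart (k : Fin 3 → ℤ) (x y : E3) :
    fderiv ℝ (hart k) x y = ⟪freq k, y⟫ * hart (-k) x := by
  rw [(hasFDerivAt_hart k x).fderiv]
  simp [mul_comm]

lemma abs_hart_le (k : Fin 3 → ℤ) (x : E3) : |hart k x| ≤ 2 * normConst := by
  rw [hart, abs_mul, abs_of_pos normConst_pos, mul_comm]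
  have h := abs_add_le (Real.cos ⟪freq k, x⟫) (Real.sin ⟪freq k, x⟫)
  have h1 := Real.abs_cos_le_one ⟪freq k, x⟫
  have h2 := Real.abs_sin_le_one ⟪freq k, x⟫
  exact mul_le_mul_of_nonneg_right (by linarith) normConst_pos.le

lemma measureReal_box : volume.real box = (2 * Real.pi) ^ 3 := by
  have h := setIntegral_box (fun _ => (1 : ℝ))
  simp only [integral_const, smul_eq_mul, mul_one, measureReal_restrict_apply_univ] at h
  rw [h, Measure.real, Real.volume_Icc_pi_toReal (fun _ => by positivity)]
  simp

lemma setIntegral_hart (k : Fin 3 → ℤ) :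
    ∫ x in box, hart k x = if k = 0 then normConst * (2 * Real.pi) ^ 3 else 0 := by
  split_ifs with h
  · subst h
    simp [hart_zero, measureReal_box, mul_comm]
  · obtain ⟨j, hj⟩ := Function.ne_iff.1 h
    have h1 := setIntegral_box_fderiv_eq_zero (contDiff_hart (-k)) (isPeriodic_hart (-k)) j
    simp_rw [fderiv_hart, neg_neg, integral_const_mul, inner_freq_e] at h1
    refine (mul_eq_zero.1 h1).resolve_left ?_
    simpa using hj

lemma hart_mul_hart (k l : Fin 3 → ℤ) (x : E3) : hart k x * hart l x = normConst / 2 *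
    (hart (k - l) x + hart (l - k) x + hart (k + l) x - hart (-(k + l)) x) := by
  simp only [hart, freq_sub, freq_add, freq_neg, inner_sub_left, inner_add_left, inner_neg_left,
    Real.cos_sub, Real.sin_sub, Real.cos_add, Real.sin_add, Real.cos_neg, Real.sin_neg, neg_add]
  ring

lemma setIntegral_hart_mul_hart (k l : Fin 3 → ℤ) :
    ∫ x in box, hart k x * hart l x = if k = l then 1 else 0 := by
  have hi : ∀ k, IntegrableOn (hart k) box := fun k =>
    (continuous_hart k).continuousOn.integrableOn_compact isCompact_box
  simp_rw [hart_mul_hart, integral_const_mul]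
  rw [integral_sub (by exact ((hi _).add (hi _)).add (hi _)) (hi _),
    integral_add (by exact (hi _).add (hi _)) (hi _), integral_add (hi _) (hi _)]
  simp_rw [setIntegral_hart, neg_eq_zero, sub_eq_zero, eq_comm (a := l)]
  split_ifs <;> linarith [normConst_mul_self]

/-! ### Completeness of the Hartley functions -/

/-- The projection of `ℝ³` onto the torus `(ℝ/ℤ)³`, which rescales the period from `2π` to `1`. -/
def toTorus (x : E3) : UnitAddTorus (Fin 3) := fun i => ((x i / (2 * Real.pi) : ℝ) : UnitAddCircle)

lemma continuous_toTorus : Continuous toTorus := by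
  refine continuous_pi fun i => (AddCircle.continuous_mk' 1).comp ?_
  fun_prop

/-- The section of `toTorus` with values in the half-open box. -/
def torusSection (z : UnitAddTorus (Fin 3)) : E3 :=
  WithLp.toLp 2 fun i => 2 * Real.pi * (AddCircle.measurableEquivIoc 1 0 (z i) : ℝ)

lemma measurable_torusSection : Measurable torusSection := by
  refine (MeasurableEquiv.toLp 2 (Fin 3 → ℝ)).measurable.comp (measurable_pi_lambda _ fun i => ?_)
  exact ((measurable_subtype_coe.comp (AddCircle.measurableEquivIoc 1 0).measurable).comp
    (measurable_pi_apply i)).const_mul _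

lemma torusSection_toTorus : ∀ᵐ x ∂(volume.restrict box), torusSection (toTorus x) = x := by
  have h : ∀ᵐ x ∂(volume.restrict box), x ∈ WithLp.ofLp ⁻¹'
      (Set.univ.pi fun _ : Fin 3 => Ioc (0 : ℝ) (2 * Real.pi)) := by
    have h1 : (Set.univ.pi fun _ : Fin 3 => Ioc (0 : ℝ) (2 * Real.pi)) =ᵐ[volume]
        Icc (0 : Fin 3 → ℝ) fun _ => 2 * Real.pi := Measure.univ_pi_Ioc_ae_eq_Icc
    have h2 := (PiLp.volume_preserving_ofLp (Fin 3)).quasiMeasurePreserving.preimage_ae_eq h1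
    rw [← box_eq_preimage] at h2
    rw [ae_restrict_iff' isCompact_box.measurableSet]
    filter_upwards [h2] with x hx hb
    exact (eq_iff_iff.1 hx).2 hb
  filter_upwards [h] with x hx
  ext i
  have hi : x i ∈ Ioc (0 : ℝ) (2 * Real.pi) := hx i trivial
  have h3 : x i / (2 * Real.pi) ∈ Ioc (0 : ℝ) (0 + 1) :=
    ⟨by have := hi.1; positivity, by rw [zero_add, div_le_one (by positivity)]; exact hi.2⟩
  have h4 : (AddCircle.measurableEquivIoc 1 0 (toTorus x i) : ℝ) = x i / (2 * Real.pi) :=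
    congrArg Subtype.val (Equiv.apply_symm_apply (AddCircle.equivIoc (1 : ℝ) 0) ⟨_, h3⟩)
  simp only [torusSection, h4]
  field_simp

lemma mFourier_toTorus (k : Fin 3 → ℤ) (x : E3) : UnitAddTorus.mFourier k (toTorus x)
    = Real.cos ⟪freq k, x⟫ + Real.sin ⟪freq k, x⟫ * Complex.I := by
  have h : ∀ i, fourier (k i) (toTorus x i) = Complex.exp ((k i * x i : ℝ) * Complex.I) := by
    intro i
    rw [toTorus, fourier_coe_apply]
    congr 1
    have : (Real.pi : ℂ) ≠ 0 := by exact_mod_cast Real.pi_ne_zero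
    push_cast
    field_simp
  simp only [UnitAddTorus.mFourier, ContinuousMap.coe_mk, h]
  rw [← Complex.exp_sum, ← Finset.sum_mul, ← Complex.ofReal_sum, Complex.exp_mul_I,
    ← Complex.ofReal_cos, ← Complex.ofReal_sin]
  have : ∑ i, (k i : ℝ) * x i = ⟪freq k, x⟫ := by
    simp [PiLp.inner_apply, mul_comm]
  rw [this]

/-- A function on the box that is orthogonal to all Hartley functions is orthogonal to all
continuous functions on the torus. -/
lemma setIntegral_comp_toTorus_eq_zero {f : E3 → ℝ} (hf : IntegrableOn f box)
    (h0 : ∀ k, ∫ x in box, hart k x * f x = 0) (G : C(UnitAddTorus (Fin 3), ℂ)) :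
    ∫ x in box, G (toTorus x) * (f x : ℂ) = 0 := by
  have hint : ∀ G : C(UnitAddTorus (Fin 3), ℂ), IntegrableOn
      (fun x => G (toTorus x) * (f x : ℂ)) box := fun G =>
    hf.ofReal.bdd_mul (c := ‖G‖)
      (G.continuous.comp continuous_toTorus).aestronglyMeasurable
      (Filter.Eventually.of_forall fun x => G.norm_coe_le_norm _)
  let Λ : C(UnitAddTorus (Fin 3), ℂ) →L[ℂ] ℂ := LinearMap.mkContinuous
    { toFun := fun G => ∫ x in box, G (toTorus x) * (f x : ℂ)
      map_add' := fun G G' => by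
        simp only [ContinuousMap.add_apply, add_mul]
        exact integral_add (hint G) (hint G')
      map_smul' := fun c G => by
        simp only [ContinuousMap.smul_apply, smul_eq_mul, mul_assoc, RingHom.id_apply]
        exact integral_const_mul _ _ }
    (∫ x in box, ‖f x‖) fun G => by
      refine (norm_integral_le_of_norm_le (hf.norm.mul_const ‖G‖)
        (Filter.Eventually.of_forall fun x => ?_)).trans_eq (integral_mul_const _ _)
      rw [norm_mul, mul_comm, Complex.norm_real]
      gcongr
      exact G.norm_coe_le_norm _
  have hmem : ∀ G ∈ Submodule.span ℂ (range (UnitAddTorus.mFourier (d := Fin 3))), Λ G = 0 := by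
    intro G hG
    refine Submodule.span_induction ?_ (map_zero Λ) (fun x y _ _ hx hy => by simp [hx, hy])
      (fun c x _ hx => by simp [hx]) hG
    rintro _ ⟨k, rfl⟩
    have hi : ∀ k, IntegrableOn (fun x => hart k x * f x) box := fun k =>
      hf.bdd_mul (c := 2 * normConst) (continuous_hart k).aestronglyMeasurable
        (Filter.Eventually.of_forall fun x => abs_hart_le k x)
    have hc : ∀ x, UnitAddTorus.mFourier k (toTorus x) * (f x : ℂ)
        = (((2 * normConst)⁻¹ * (hart k x * f x + hart (-k) x * f x) : ℝ) : ℂ)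
          + (((2 * normConst)⁻¹ * (hart k x * f x - hart (-k) x * f x) : ℝ) : ℂ) * Complex.I := by
      intro x
      have hn : (normConst : ℂ) ≠ 0 := by exact_mod_cast normConst_pos.ne'
      rw [mFourier_toTorus]
      simp only [hart, freq_neg, inner_neg_left, Real.cos_neg, Real.sin_neg]
      push_cast
      field_simp
      ring
    change ∫ x in box, UnitAddTorus.mFourier k (toTorus x) * (f x : ℂ) = 0
    simp_rw [hc]
    rw [integral_add, integral_mul_const, integral_complex_ofReal, integral_complex_ofReal,
      integral_const_mul,
      integral_const_mul, integral_add (hi _) (hi _), integral_sub (hi _) (hi _), h0, h0]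
    · simp
    · exact (((hi _).add (hi _)).const_mul _).ofReal
    · exact (((hi _).sub (hi _)).const_mul _).ofReal.mul_const _
  have hcl : G ∈ (Submodule.span ℂ
      (range (UnitAddTorus.mFourier (d := Fin 3)))).topologicalClosure := by
    rw [UnitAddTorus.span_mFourier_closure_eq_top]; trivial
  have hclosed : IsClosed {G | Λ G = 0} := isClosed_eq Λ.continuous continuous_const
  exact closure_minimal (fun G hG => hmem G hG) hclosed hcl

/-- Completeness of the Hartley functions: the positive and the negative part of a function
orthogonal to all of them define the same measure on the torus, hence on the box. -/
lemma ae_eq_zero_of_forall_setIntegral_hart {f : E3 → ℝ} (hf : IntegrableOn f box)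
    (h0 : ∀ k, ∫ x in box, hart k x * f x = 0) : f =ᵐ[volume.restrict box] 0 := by
  let μ : (E3 → ℝ) → Measure E3 := fun g =>
    (volume.restrict box).withDensity fun x => ENNReal.ofReal (g x)
  have hfin : ∀ g : E3 → ℝ, IntegrableOn g box → IsFiniteMeasure (μ g) := fun g hg =>
    isFiniteMeasure_withDensity_ofReal hg.2
  have := hfin f hf
  have := hfin (-f) hf.neg
  have hac : ∀ g, μ g ≪ volume.restrict box := fun g => withDensity_absolutelyContinuous _ _
  have hback : ∀ g, μ g = ((μ g).map toTorus).map torusSection := by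
    intro g
    rw [Measure.map_map measurable_torusSection continuous_toTorus.measurable]
    conv_lhs => rw [← Measure.map_id (μ := μ g)]
    refine Measure.map_congr ?_
    filter_upwards [(hac g).ae_le torusSection_toTorus] with x hx
    exact hx.symm
  have hG : ∀ (g : E3 → ℝ), IntegrableOn g box → ∀ G : BoundedContinuousFunction
      (UnitAddTorus (Fin 3)) ℝ, ∫ z, G z ∂((μ g).map toTorus)
        = ∫ x in box, max (g x) 0 * G (toTorus x) := by
    intro g hg G
    rw [integral_map continuous_toTorus.aemeasurable G.continuous.aestronglyMeasurable]
    rw [integral_withDensity_eq_integral_toReal_smul₀ hg.1.aemeasurable.ennreal_ofReal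
      (Filter.Eventually.of_forall fun _ => ENNReal.ofReal_lt_top)]
    rfl
  have hmap : (μ f).map toTorus = (μ (-f)).map toTorus := by
    refine ext_of_forall_integral_eq_of_IsFiniteMeasure fun G => ?_
    rw [hG f hf, hG (-f) hf.neg, ← sub_eq_zero]
    have hint : ∀ g : E3 → ℝ, IntegrableOn g box →
        IntegrableOn (fun x => max (g x) 0 * G (toTorus x)) box := fun g hg =>
      (hg.pos_part).mul_bdd (c := ‖G‖)
        (G.continuous.comp continuous_toTorus).aestronglyMeasurable
        (Filter.Eventually.of_forall fun x => G.norm_coe_le_norm _)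
    rw [← integral_sub (hint f hf) (hint (-f) hf.neg)]
    have h1 := setIntegral_comp_toTorus_eq_zero hf h0
      ⟨fun z => (G z : ℂ), Complex.continuous_ofReal.comp G.continuous⟩
    simp only [ContinuousMap.coe_mk, ← Complex.ofReal_mul, integral_complex_ofReal] at h1
    rw [← Complex.ofReal_eq_zero, ← h1]
    congr 2
    ext x
    rw [← sub_mul, mul_comm]
    congr 1
    simp only [Pi.neg_apply]
    rcases le_total (f x) 0 with h | h
    · rw [max_eq_right h, max_eq_left (by linarith)]; ring
    · rw [max_eq_left h, max_eq_right (by linarith)]; ring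
  have hμ : μ f = μ (-f) := by rw [hback f, hback (-f), hmap]
  have hd := (withDensity_eq_iff hf.1.aemeasurable.ennreal_ofReal
    hf.neg.1.aemeasurable.ennreal_ofReal hf.lintegral_lt_top.ne).1 hμ
  filter_upwards [hd] with x hx
  simp only [Pi.neg_apply] at hx
  rcases le_total (f x) 0 with h | h
  · rw [ENNReal.ofReal_of_nonpos h, eq_comm, ENNReal.ofReal_eq_zero] at hx
    simp; linarith
  · rw [ENNReal.ofReal_of_nonpos (p := -f x) (by linarith), ENNReal.ofReal_eq_zero] at hx
    simp; linarith

/-! ### Fourier series of square integrable fields -/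

/-- The class in `L²` of a continuous field. -/
def toL2 (f : E3 → E3) (hf : Continuous f) : L2 := (memLp_of_continuous hf).toLp f

lemma coeFn_toL2 {f : E3 → E3} (hf : Continuous f) : toL2 f hf =ᵐ[volume.restrict box] f :=
  (memLp_of_continuous hf).coeFn_toLp

lemma inner_toL2_left {f : E3 → E3} (hf : Continuous f) (v : L2) :
    ⟪toL2 f hf, v⟫ = ∫ x in box, ⟪f x, v x⟫ := by
  rw [MeasureTheory.L2.inner_def]
  refine integral_congr_ae ?_
  filter_upwards [coeFn_toL2 hf] with x hx
  rw [hx]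

lemma continuous_hart_smul (k : Fin 3 → ℤ) (a : E3) : Continuous fun x => hart k x • a :=
  (continuous_hart k).smul continuous_const

/-- The field `x ↦ hart k x • a`, as a function of the amplitude `a`. -/
def mode (k : Fin 3 → ℤ) : E3 →ₗᵢ[ℝ] L2 where
  toFun a := toL2 (fun x => hart k x • a) (continuous_hart_smul k a)
  map_add' a b := by
    simp only [smul_add, toL2]
    exact MemLp.toLp_add (memLp_of_continuous (continuous_hart_smul k a))
      (memLp_of_continuous (continuous_hart_smul k b))
  map_smul' c a := by
    simp only [smul_comm _ c, toL2, RingHom.id_apply]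
    exact MemLp.toLp_const_smul c (memLp_of_continuous (continuous_hart_smul k a))
  norm_map' a := by
    have hc := continuous_hart_smul k a
    change ‖toL2 (fun x => hart k x • a) hc‖ = ‖a‖
    refine (sq_eq_sq₀ (norm_nonneg _) (norm_nonneg _)).1 ?_
    rw [← real_inner_self_eq_norm_sq, ← real_inner_self_eq_norm_sq, inner_toL2_left]
    have h : (fun x => ⟪hart k x • a, toL2 (fun x => hart k x • a) hc x⟫)
        =ᵐ[volume.restrict box] fun x => hart k x * hart k x * ⟪a, a⟫ := by
      filter_upwards [coeFn_toL2 hc] with x hx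
      rw [hx, real_inner_smul_left, real_inner_smul_right, mul_assoc]
    rw [integral_congr_ae h, integral_mul_const, setIntegral_hart_mul_hart]
    simp

lemma mode_eq_toL2 (k : Fin 3 → ℤ) (a : E3) :
    mode k a = toL2 (fun x => hart k x • a) (continuous_hart_smul k a) := rfl

/-- The Fourier coefficient of index `k` of a square integrable field, with respect to the Hartley
basis. -/
def hat (k : Fin 3 → ℤ) : L2 →L[ℝ] E3 :=
  ContinuousLinearMap.adjoint (mode k).toContinuousLinearMap

lemma inner_mode_left (k : Fin 3 → ℤ) (a : E3) (v : L2) : ⟪mode k a, v⟫ = ⟪a, hat k v⟫ :=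
  (ContinuousLinearMap.adjoint_inner_right (mode k).toContinuousLinearMap a v).symm

lemma hat_eq_integral (k : Fin 3 → ℤ) (v : L2) : hat k v = ∫ x in box, hart k x • v x := by
  refine ext_inner_left ℝ fun a => ?_
  rw [← inner_mode_left, mode_eq_toL2, inner_toL2_left,
    ← integral_inner (integrable_smul_field (continuous_hart k) v)]
  simp only [real_inner_smul_left, real_inner_smul_right]

lemma hat_toL2 (k : Fin 3 → ℤ) {f : E3 → E3} (hf : Continuous f) :
    hat k (toL2 f hf) = ∫ x in box, hart k x • f x := by
  rw [hat_eq_integral]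
  refine integral_congr_ae ?_
  filter_upwards [coeFn_toL2 hf] with x hx
  rw [hx]

lemma norm_hat_le (k : Fin 3 → ℤ) (v : L2) : ‖hat k v‖ ≤ ‖v‖ := by
  have h := inner_mode_left k (hat k v) v
  rw [real_inner_self_eq_norm_sq] at h
  have h1 := real_inner_le_norm (mode k (hat k v)) v
  rw [h, LinearIsometry.norm_map, sq] at h1
  rcases (norm_nonneg (hat k v)).eq_or_lt with h0 | h0
  · rw [← h0]; exact norm_nonneg v
  · exact le_of_mul_le_mul_left h1 h0

lemma hat_mode (k l : Fin 3 → ℤ) (a : E3) : hat k (mode l a) = if k = l then a else 0 := by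
  rw [mode_eq_toL2, hat_toL2]
  simp_rw [smul_smul]
  rw [integral_smul_const, setIntegral_hart_mul_hart]
  split_ifs <;> simp

lemma orthogonalFamily_mode : OrthogonalFamily ℝ (fun _ : Fin 3 → ℤ => E3) mode := by
  intro k l hkl a b
  rw [inner_mode_left, hat_mode, if_neg hkl, inner_zero_right]

lemma eq_zero_of_forall_hat {v : L2} (h : ∀ k, hat k v = 0) : v = 0 := by
  have hv := integrable_field v
  have h1 : ∀ i, (fun x => v x i) =ᵐ[volume.restrict box] 0 := by
    intro i
    refine ae_eq_zero_of_forall_setIntegral_hart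
      ((EuclideanSpace.proj (𝕜 := ℝ) i).integrable_comp hv) fun k => ?_
    have h2 := ((EuclideanSpace.proj (𝕜 := ℝ) i).integral_comp_comm
      (integrable_smul_field (continuous_hart k) v)).trans
      (congrArg _ ((hat_eq_integral k v).symm.trans (h k)))
    simpa using h2
  rw [Lp.eq_zero_iff_ae_eq_zero]
  filter_upwards [h1 0, h1 1, h1 2] with x h0 h1 h2
  ext i
  fin_cases i
  exacts [h0, h1, h2]

lemma isHilbertSum_mode : IsHilbertSum ℝ (fun _ : Fin 3 → ℤ => E3) mode := by
  refine IsHilbertSum.mk (G := fun _ : Fin 3 → ℤ => E3) orthogonalFamily_mode ?_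
  rw [top_le_iff, Submodule.topologicalClosure_eq_top_iff, Submodule.eq_bot_iff]
  intro v hv
  refine eq_zero_of_forall_hat fun k => ext_inner_left ℝ fun a => ?_
  rw [← inner_mode_left, inner_zero_right]
  exact hv _ (Submodule.mem_iSup_of_mem k ⟨a, rfl⟩)

lemma linearIsometryEquiv_apply_eq_hat (v : L2) (k : Fin 3 → ℤ) :
    isHilbertSum_mode.linearIsometryEquiv v k = hat k v := by
  classical
  refine ext_inner_left ℝ fun a => ?_
  rw [← inner_mode_left, ← isHilbertSum_mode.linearIsometryEquiv_symm_apply_single,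
    ← LinearIsometryEquiv.inner_map_map isHilbertSum_mode.linearIsometryEquiv,
    LinearIsometryEquiv.apply_symm_apply, lp.inner_single_left]

lemma hasSum_mode_hat (v : L2) : HasSum (fun k => mode k (hat k v)) v := by
  have h := isHilbertSum_mode.hasSum_linearIsometryEquiv_symm
    (isHilbertSum_mode.linearIsometryEquiv v)
  simpa only [linearIsometryEquiv_apply_eq_hat, LinearIsometryEquiv.symm_apply_apply] using h

/-- Parseval's identity. -/
lemma hasSum_inner_hat (v w : L2) : HasSum (fun k => ⟪hat k v, hat k w⟫) ⟪v, w⟫ := by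
  have h := lp.hasSum_inner (𝕜 := ℝ) (G := fun _ : Fin 3 → ℤ => E3)
    (isHilbertSum_mode.linearIsometryEquiv v) (isHilbertSum_mode.linearIsometryEquiv w)
  simpa only [linearIsometryEquiv_apply_eq_hat, LinearIsometryEquiv.inner_map_map] using h

lemma hasSum_norm_hat_sq (v : L2) : HasSum (fun k => ‖hat k v‖ ^ 2) (‖v‖ ^ 2) := by
  simpa only [real_inner_self_eq_norm_sq] using hasSum_inner_hat v v

lemma hat_injective {v w : L2} (h : ∀ k, hat k v = hat k w) : v = w :=
  sub_eq_zero.1 (eq_zero_of_forall_hat fun k => by rw [map_sub, h, sub_self])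

/-- Riesz–Fischer: every square summable family is the family of coefficients of a field. -/
lemma exists_hat_eq {a : (Fin 3 → ℤ) → E3} (ha : Summable fun k => ‖a k‖ ^ 2) :
    ∃ v : L2, ∀ k, hat k v = a k := by
  have hm : Memℓp a 2 := memℓp_gen (by simpa using ha)
  refine ⟨isHilbertSum_mode.linearIsometryEquiv.symm ⟨a, hm⟩, fun k => ?_⟩
  rw [← linearIsometryEquiv_apply_eq_hat, LinearIsometryEquiv.apply_symm_apply]

/-! ### Fourier characterizations: incompressibility, derivatives, filtering -/

/-- The symbol of the Leray projector: the orthogonal projection of an amplitude onto the plane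
orthogonal to the wave vector. It vanishes for `k = 0`, so that mean values are removed. -/
def leray (k : Fin 3 → ℤ) : E3 →L[ℝ] E3 :=
  if k = 0 then 0 else (ℝ ∙ freq k)ᗮ.starProjection

lemma leray_neg (k : Fin 3 → ℤ) : leray (-k) = leray k := by
  have h : (ℝ ∙ (-freq k)) = ℝ ∙ freq k := by
    rw [← Set.neg_singleton, Submodule.span_neg]
  simp [leray, freq_neg, h]

lemma inner_leray_left (k : Fin 3 → ℤ) (a b : E3) : ⟪leray k a, b⟫ = ⟪a, leray k b⟫ := by
  unfold leray
  split_ifs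
  · simp
  · exact Submodule.inner_starProjection_left_eq_right _ _ _

lemma inner_freq_leray (k : Fin 3 → ℤ) (a : E3) : ⟪freq k, leray k a⟫ = 0 := by
  unfold leray
  split_ifs
  · simp
  · exact Submodule.mem_orthogonal_singleton_iff_inner_right.1
      (Submodule.starProjection_apply_mem _ _)

lemma norm_leray_le (k : Fin 3 → ℤ) (a : E3) : ‖leray k a‖ ≤ ‖a‖ := by
  unfold leray
  split_ifs
  · simp
  · exact Submodule.norm_starProjection_apply_le _ _

lemma leray_eq_self {k : Fin 3 → ℤ} (hk : k ≠ 0) {a : E3} (h : ⟪freq k, a⟫ = 0) :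
    leray k a = a := by
  rw [leray, if_neg hk]
  exact Submodule.starProjection_eq_self_iff.2
    (Submodule.mem_orthogonal_singleton_iff_inner_right.2 h)

@[simp] lemma leray_leray (k : Fin 3 → ℤ) (a : E3) : leray k (leray k a) = leray k a := by
  by_cases hk : k = 0
  · simp [leray, hk]
  · exact leray_eq_self hk (inner_freq_leray k a)

/-- Membership in `H` in terms of Fourier coefficients. -/
lemma mem_H_iff {v : L2} : v ∈ H ↔ ∀ k, leray k (hat k v) = hat k v := by
  constructor
  · rintro ⟨h0, hdiv⟩ k
    by_cases hk : k = 0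
    · have : hat k v = 0 := by
        rw [hat_eq_integral, hk]
        simp_rw [hart_zero]
        rw [integral_smul, h0, smul_zero]
      rw [this, map_zero]
    · refine leray_eq_self hk ?_
      have h := hdiv _ (isSmoothPeriodic_hart (-k))
      have hg : ∀ x, ∇ (hart (-k)) x = -(hart k x • freq k) := by
        intro x
        refine ext_inner_right ℝ fun y => ?_
        rw [gradient, InnerProductSpace.toDual_symm_apply, fderiv_hart, neg_neg, freq_neg,
          inner_neg_left, inner_neg_left, real_inner_smul_left]
        ring
      simp_rw [hg, inner_neg_right, integral_neg, neg_eq_zero] at h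
      rw [hat_eq_integral, ← integral_inner (integrable_smul_field (continuous_hart k) v), ← h]
      refine integral_congr_ae (Filter.Eventually.of_forall fun x => ?_)
      simp only [real_inner_smul_right]
      rw [real_inner_comm]
  · intro h
    constructor
    · have h0 := h 0
      simp only [leray, if_true, zero_apply] at h0
      rw [hat_eq_integral] at h0
      simp_rw [hart_zero] at h0
      rw [integral_smul] at h0
      exact (smul_eq_zero.1 h0.symm).resolve_left normConst_pos.ne'
    · intro q hq
      have h1 : ∫ x in box, ⟪v x, ∇ q x⟫ = ⟪toL2 (∇ q) hq.continuous_gradient, v⟫ := by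
        rw [inner_toL2_left]
        simp only [real_inner_comm]
      rw [h1, ← (hasSum_inner_hat _ v).tsum_eq]
      refine (tsum_congr fun k => ?_).trans tsum_zero
      rw [hat_toL2, ← h k, real_inner_comm, ← integral_inner (by
        exact (((continuous_hart k).smul hq.continuous_gradient).continuousOn.integrableOn_compact
          isCompact_box))]
      have h2 := setIntegral_box_fderiv_smul (contDiff_hart k) (isPeriodic_hart k)
        (hq.smooth.of_le (by simp)) hq.periodic (leray k (hat k v))
      simp_rw [fderiv_hart, inner_freq_leray, zero_mul, zero_smul, integral_zero] at h2
      rw [eq_comm, neg_eq_zero] at h2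
      rw [← h2]
      refine integral_congr_ae (Filter.Eventually.of_forall fun x => ?_)
      simp only [real_inner_smul_right, smul_eq_mul]
      rw [real_inner_comm, gradient, InnerProductSpace.toDual_symm_apply]

/-- Differentiation in Fourier variables; the reflection of the index comes from the Hartley
functions. -/
lemma IsWeakPartial.hat_eq {j : Fin 3} {v g : L2} (h : IsWeakPartial j v g) (k : Fin 3 → ℤ) :
    hat k g = -((k j : ℝ) • hat (-k) v) := by
  have h1 := h _ (isSmoothPeriodic_hart k)
  simp_rw [fderiv_hart, inner_freq_e, mul_smul, integral_smul] at h1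
  rw [hat_eq_integral, hat_eq_integral, h1, neg_neg]

lemma isWeakPartial_toL2 {φ : E3 → E3} (hφ : ContDiff ℝ 1 φ) (hp : IsPeriodic φ) (j : Fin 3) :
    IsWeakPartial j (toL2 φ hφ.continuous) (toL2 (fun x => fderiv ℝ φ x (e j))
      ((hφ.continuous_fderiv one_ne_zero).clm_apply continuous_const)) := by
  intro q hq
  have h := setIntegral_box_fderiv_smul (hq.smooth.of_le (by simp)) hq.periodic hφ hp (e j)
  have h1 := coeFn_toL2 hφ.continuous
  have h2 := coeFn_toL2 ((hφ.continuous_fderiv one_ne_zero).clm_apply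
    (continuous_const (y := e j)))
  refine (integral_congr_ae ?_).trans (h.trans (congrArg Neg.neg (integral_congr_ae ?_)))
  · filter_upwards [h1] with x hx
    rw [hx]
  · filter_upwards [h2] with x hx
    rw [hx]

lemma IsSmoothPeriodic.fderiv_apply {q : E3 → ℝ} (hq : IsSmoothPeriodic q) (y : E3) :
    IsSmoothPeriodic fun x => fderiv ℝ q x y where
  smooth := (hq.smooth.fderiv_right (m := ∞) (by simp)).clm_apply contDiff_const
  periodic := fun j x => by
    have h : (fun z => q (z + (2 * Real.pi) • e j)) = q := funext (hq.periodic j)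
    have h1 := fderiv_comp_add_right (𝕜 := ℝ) (f := q) (x := x) ((2 * Real.pi) • e j)
    rw [h] at h1
    simp only [h1]

lemma laplacian_eq_sum {q : E3 → ℝ} (hq : IsSmoothPeriodic q) (x : E3) :
    Laplacian.laplacian q x = ∑ j, fderiv ℝ (fun z => fderiv ℝ q z (e j)) x (e j) := by
  rw [InnerProductSpace.laplacian_eq_iteratedFDeriv_orthonormalBasis q
    (EuclideanSpace.basisFun (Fin 3) ℝ)]
  refine Finset.sum_congr rfl fun j _ => ?_
  rw [iteratedFDeriv_two_apply]
  have hd : DifferentiableAt ℝ (fderiv ℝ q) x :=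
    ((hq.smooth.fderiv_right (m := 1) (by norm_cast)).differentiable one_ne_zero).differentiableAt
  rw [fderiv_clm_apply hd (differentiableAt_const _)]
  simp

lemma IsSmoothPeriodic.continuous_laplacian {q : E3 → ℝ} (hq : IsSmoothPeriodic q) :
    Continuous (Laplacian.laplacian q) := by
  have h : Laplacian.laplacian q
      = fun x => ∑ j, fderiv ℝ (fun z => fderiv ℝ q z (e j)) x (e j) :=
    funext (laplacian_eq_sum hq)
  rw [h]
  exact continuous_finsetSum _ fun j _ => (hq.fderiv_apply (e j)).continuous_fderiv_apply _

lemma norm_freq_sq (k : Fin 3 → ℤ) : ‖freq k‖ ^ 2 = ∑ j, (k j : ℝ) ^ 2 := by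
  simp [EuclideanSpace.norm_sq_eq]

lemma setIntegral_hart_mul_laplacian {q : E3 → ℝ} (hq : IsSmoothPeriodic q) (k : Fin 3 → ℤ) :
    ∫ x in box, hart k x * Laplacian.laplacian q x
      = -(‖freq k‖ ^ 2 * ∫ x in box, hart k x * q x) := by
  simp_rw [laplacian_eq_sum hq, Finset.mul_sum]
  have hi : ∀ j, IntegrableOn (fun x => hart k x *
      fderiv ℝ (fun z => fderiv ℝ q z (e j)) x (e j)) box := fun j => ((continuous_hart k).mul
    ((hq.fderiv_apply (e j)).continuous_fderiv_apply _)).continuousOn.integrableOn_compact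
      isCompact_box
  rw [integral_finsetSum _ fun j _ => hi j, norm_freq_sq, Finset.sum_mul, ← Finset.sum_neg_distrib]
  refine Finset.sum_congr rfl fun j _ => ?_
  have h1 := setIntegral_box_fderiv_smul (contDiff_hart k) (isPeriodic_hart k)
    ((hq.fderiv_apply (e j)).smooth.of_le (by simp)) (hq.fderiv_apply (e j)).periodic (e j)
  have h2 := setIntegral_box_fderiv_smul (contDiff_hart (-k)) (isPeriodic_hart (-k))
    (hq.smooth.of_le (by simp)) hq.periodic (e j)
  simp only [fderiv_hart, inner_freq_e, neg_neg, smul_eq_mul, mul_assoc, integral_const_mul]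
    at h1 h2
  rw [← neg_eq_iff_eq_neg] at h1
  rw [← h1, ← neg_eq_iff_eq_neg.2 h2]
  simp
  ring

/-- In Fourier variables, filtering is division by `1 + α|k|²`. -/
lemma isFiltered_of_hat {α : ℝ} {v u : L2}
    (h : ∀ k, hat k v = (1 + α * ‖freq k‖ ^ 2) • hat k u) : IsFiltered α v u := by
  intro q hq
  have hL := hq.continuous_laplacian
  have hc1 : Continuous fun x => q x - α * Laplacian.laplacian q x :=
    hq.smooth.continuous.sub (continuous_const.mul hL)
  refine ext_inner_left ℝ fun a => ?_
  rw [← integral_inner (integrable_smul_field hc1 u),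
    ← integral_inner (integrable_smul_field hq.smooth.continuous v)]
  have hs : ∀ (f : E3 → ℝ) (hf : Continuous f) (w : L2),
      ∫ x in box, ⟪a, f x • w x⟫ = ⟪toL2 (fun x => f x • a) (hf.smul continuous_const), w⟫ := by
    intro f hf w
    rw [inner_toL2_left]
    simp only [real_inner_smul_left, real_inner_smul_right]
  rw [hs _ hc1, hs _ hq.smooth.continuous, ← (hasSum_inner_hat _ u).tsum_eq,
    ← (hasSum_inner_hat _ v).tsum_eq]
  refine tsum_congr fun k => ?_
  rw [h k, hat_toL2, hat_toL2]
  simp_rw [smul_smul]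
  rw [integral_smul_const, integral_smul_const]
  have hi1 : IntegrableOn (fun x => hart k x * q x) box :=
    ((continuous_hart k).mul hq.smooth.continuous).continuousOn.integrableOn_compact isCompact_box
  have hi2 : IntegrableOn (fun x => hart k x * Laplacian.laplacian q x) box :=
    ((continuous_hart k).mul hL).continuousOn.integrableOn_compact isCompact_box
  have h3 : ∫ x in box, hart k x * (q x - α * Laplacian.laplacian q x)
      = (1 + α * ‖freq k‖ ^ 2) * ∫ x in box, hart k x * q x := by
    simp_rw [mul_sub, mul_left_comm _ α]
    rw [integral_sub hi1 (hi2.const_mul α), integral_const_mul, setIntegral_hart_mul_laplacian hq]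
    ring
  rw [h3, real_inner_smul_left, real_inner_smul_left, real_inner_smul_right]
  ring

/-- The symbol of `(1 - αΔ)⁻¹`. -/
def filterSymbol (α : ℝ) (k : Fin 3 → ℤ) : ℝ := (1 + α * ‖freq k‖ ^ 2)⁻¹

lemma filterSymbol_nonneg {α : ℝ} (hα : 0 < α) (k : Fin 3 → ℤ) : 0 ≤ filterSymbol α k := by
  unfold filterSymbol; positivity

lemma filterSymbol_le_one {α : ℝ} (hα : 0 < α) (k : Fin 3 → ℤ) : filterSymbol α k ≤ 1 := by
  unfold filterSymbol
  exact inv_le_one_of_one_le₀ (le_add_of_nonneg_right (by positivity))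

lemma freq_injective : Function.Injective freq := fun k l h => by
  ext i
  have := congrArg (fun z : E3 => z i) h
  simpa using this

/-- The filter gains two derivatives, which is more than half of the dimension: its symbol is square
summable over `ℤ³`. -/
lemma summable_filterSymbol_sq {α : ℝ} (hα : 0 < α) :
    Summable fun k => filterSymbol α k ^ 2 := by
  let b := (EuclideanSpace.basisFun (Fin 3) ℝ).toBasis
  let L : Submodule ℤ E3 := Submodule.span ℤ (range b)
  have hmem : ∀ k, freq k ∈ L := by
    intro k
    have : freq k = ∑ i, k i • b i := by
      ext j
      simp [b, Finset.sum_apply, Pi.single_apply]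
    rw [this]
    exact Submodule.sum_mem _ fun i _ => Submodule.smul_mem _ _ (Submodule.subset_span ⟨i, rfl⟩)
  have hrank : Module.finrank ℤ L = 3 := by
    rw [ZLattice.rank ℝ L]
    simp
  have hs := (ZLattice.summable_norm_pow_inv L 4 (by rw [hrank]; norm_num)).comp_injective
    (i := fun k => (⟨freq k, hmem k⟩ : L)) fun k l h => freq_injective (congrArg Subtype.val h)
  refine Summable.of_norm_bounded_eventually (hs.mul_left (α⁻¹ ^ 2)) ?_
  have h0 : ∀ᶠ k in Filter.cofinite, k ≠ (0 : Fin 3 → ℤ) := Filter.eventually_cofinite_ne 0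
  filter_upwards [h0] with k hk
  have hk' : 0 < ‖freq k‖ := norm_pos_iff.2 fun h => hk (freq_injective (by rw [h]; ext i; simp))
  rw [Real.norm_eq_abs, abs_of_nonneg (by positivity)]
  simp only [filterSymbol, Function.comp, Submodule.coe_norm]
  have h4 : α⁻¹ ^ 2 * ‖freq k‖⁻¹ ^ 4 = (α * ‖freq k‖ ^ 2)⁻¹ ^ 2 := by
    field_simp
  rw [h4]
  gcongr
  linarith

/-! ### The transport term -/

lemma integrable_norm_mul_norm (u v : L2) :
    Integrable (fun x => ‖u x‖ * ‖v x‖) (volume.restrict box) :=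
  (Lp.memLp u).norm.integrable_mul (Lp.memLp v).norm

lemma setIntegral_norm_mul_norm_le (u v : L2) : ∫ x in box, ‖u x‖ * ‖v x‖ ≤ ‖u‖ * ‖v‖ := by
  have h := real_inner_le_norm (Lp.memLp u).norm.toLp (Lp.memLp v).norm.toLp
  rw [MeasureTheory.L2.inner_def, Lp.norm_toLp, Lp.norm_toLp, eLpNorm_norm, eLpNorm_norm] at h
  refine le_trans (le_of_eq (integral_congr_ae ?_)) h
  filter_upwards [(Lp.memLp u).norm.coeFn_toLp, (Lp.memLp v).norm.coeFn_toLp] with x hu hv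
  rw [hu, hv]
  simp [mul_comm]

lemma exists_bound_fderiv {φ : E3 → E3} (hφ : ContDiff ℝ 1 φ) :
    ∃ C, 0 ≤ C ∧ ∀ x ∈ box, ‖fderiv ℝ φ x‖ ≤ C := by
  obtain ⟨C, hC⟩ := isCompact_box.exists_bound_of_continuousOn
    (hφ.continuous_fderiv one_ne_zero).continuousOn
  exact ⟨max C 0, le_max_right _ _, fun x hx => (hC x hx).trans (le_max_left _ _)⟩

lemma aestronglyMeasurable_fderiv_apply {φ : E3 → E3} (hφ : ContDiff ℝ 1 φ) (u : L2) :
    AEStronglyMeasurable (fun x => fderiv ℝ φ x (u x)) (volume.restrict box) :=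
  (isBoundedBilinearMap_apply (𝕜 := ℝ) (E := E3) (F := E3)).continuous.comp_aestronglyMeasurable
    ((hφ.continuous_fderiv one_ne_zero).aestronglyMeasurable.prodMk (Lp.aestronglyMeasurable u))

lemma norm_inner_fderiv_le {φ : E3 → E3} {C : ℝ} (hC : ∀ x ∈ box, ‖fderiv ℝ φ x‖ ≤ C)
    (u v : L2) : ∀ᵐ x ∂(volume.restrict box),
      ‖⟪fderiv ℝ φ x (u x), v x⟫‖ ≤ C * (‖u x‖ * ‖v x‖) := by
  refine (ae_restrict_iff' isCompact_box.measurableSet).2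
    (Filter.Eventually.of_forall fun x hx => ?_)
  refine (norm_inner_le_norm _ _).trans ?_
  rw [← mul_assoc]
  exact mul_le_mul_of_nonneg_right ((fderiv ℝ φ x).le_of_opNorm_le (hC x hx) _) (norm_nonneg _)

lemma integrable_transport {φ : E3 → E3} (hφ : ContDiff ℝ 1 φ) (u v : L2) :
    Integrable (fun x => ⟪fderiv ℝ φ x (u x), v x⟫) (volume.restrict box) := by
  obtain ⟨C, _, hC⟩ := exists_bound_fderiv hφ
  exact ((integrable_norm_mul_norm u v).const_mul C).mono'
    ((aestronglyMeasurable_fderiv_apply hφ u).inner (Lp.aestronglyMeasurable v))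
    (norm_inner_fderiv_le hC u v)

lemma abs_transport_le {φ : E3 → E3} {C : ℝ} (hC0 : 0 ≤ C)
    (hC : ∀ x ∈ box, ‖fderiv ℝ φ x‖ ≤ C) (u v : L2) :
    ‖transport u v φ‖ ≤ C * ‖u‖ * ‖v‖ := by
  refine (norm_integral_le_of_norm_le ((integrable_norm_mul_norm u v).const_mul C)
    (norm_inner_fderiv_le hC u v)).trans ?_
  rw [integral_const_mul, mul_assoc]
  exact mul_le_mul_of_nonneg_left (setIntegral_norm_mul_norm_le u v) hC0

/-- The transport term as a bounded bilinear form in `(u, v)`, for a fixed field of class `C¹`. -/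
def transportForm (φ : E3 → E3) (hφ : ContDiff ℝ 1 φ) : L2 →L[ℝ] L2 →L[ℝ] ℝ :=
  LinearMap.mkContinuous₂ (LinearMap.mk₂ ℝ (fun u v => transport u v φ)
    (fun u u' v => by
      simp only [transport]
      rw [← integral_add (integrable_transport hφ u v) (integrable_transport hφ u' v)]
      refine integral_congr_ae ?_
      filter_upwards [Lp.coeFn_add u u'] with x hx
      rw [hx, Pi.add_apply, map_add, inner_add_left])
    (fun c u v => by
      simp only [transport, smul_eq_mul]
      rw [← integral_const_mul]
      refine integral_congr_ae ?_
      filter_upwards [Lp.coeFn_smul c u] with x hx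
      rw [hx, Pi.smul_apply, map_smul, real_inner_smul_left])
    (fun u v v' => by
      simp only [transport]
      rw [← integral_add (integrable_transport hφ u v) (integrable_transport hφ u v')]
      refine integral_congr_ae ?_
      filter_upwards [Lp.coeFn_add v v'] with x hx
      rw [hx, Pi.add_apply, inner_add_right])
    (fun c u v => by
      simp only [transport, smul_eq_mul]
      rw [← integral_const_mul]
      refine integral_congr_ae ?_
      filter_upwards [Lp.coeFn_smul c v] with x hx
      rw [hx, Pi.smul_apply, real_inner_smul_right]))
    (exists_bound_fderiv hφ).choose fun u v =>
      abs_transport_le (exists_bound_fderiv hφ).choose_spec.1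
        (exists_bound_fderiv hφ).choose_spec.2 u v

@[simp] lemma transportForm_apply {φ : E3 → E3} (hφ : ContDiff ℝ 1 φ) (u v : L2) :
    transportForm φ hφ u v = transport u v φ := rfl

lemma transport_sum_smul {ι : Type*} (s : Finset ι) (c : ι → ℝ) {φ : ι → E3 → E3}
    (hφ : ∀ i, ContDiff ℝ 1 (φ i)) (u v : L2) :
    transport u v (fun x => ∑ i ∈ s, c i • φ i x) = ∑ i ∈ s, c i * transport u v (φ i) := by
  have h : ∀ x, fderiv ℝ (fun x => ∑ i ∈ s, c i • φ i x) x = ∑ i ∈ s, c i • fderiv ℝ (φ i) x := by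
    intro x
    have hd : ∀ i, DifferentiableAt ℝ (φ i) x := fun i =>
      ((hφ i).differentiable one_ne_zero).differentiableAt
    exact (HasFDerivAt.fun_sum fun i _ => (hd i).hasFDerivAt.const_smul (c i)).fderiv
  simp only [transport]
  simp_rw [h, sum_apply, sum_inner, smul_apply, real_inner_smul_left]
  rw [integral_finsetSum _ fun i _ => (integrable_transport (hφ i) u v).const_mul (c i)]
  simp_rw [integral_const_mul]

lemma transport_sub {φ ψ : E3 → E3} (hφ : ContDiff ℝ 1 φ) (hψ : ContDiff ℝ 1 ψ) (u v : L2) :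
    transport u v (φ - ψ) = transport u v φ - transport u v ψ := by
  simp only [transport]
  rw [← integral_sub (integrable_transport hφ u v) (integrable_transport hψ u v)]
  refine integral_congr_ae (Filter.Eventually.of_forall fun x => ?_)
  simp only
  rw [fderiv_sub (hφ.differentiable one_ne_zero).differentiableAt
    (hψ.differentiable one_ne_zero).differentiableAt, sub_apply, inner_sub_left]

/-- The partial derivative `∂φ/∂xʲ` of a field of class `C¹`, as an element of `L²`. -/
def partialL2 (φ : E3 → E3) (hφ : ContDiff ℝ 1 φ) (j : Fin 3) : L2 :=
  toL2 (fun x => fderiv ℝ φ x (e j))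
    ((hφ.continuous_fderiv one_ne_zero).clm_apply continuous_const)

lemma coeFn_partialL2 {φ : E3 → E3} (hφ : ContDiff ℝ 1 φ) (j : Fin 3) :
    partialL2 φ hφ j =ᵐ[volume.restrict box] fun x => fderiv ℝ φ x (e j) := coeFn_toL2 _

lemma partialL2_sub {φ ψ : E3 → E3} (hφ : ContDiff ℝ 1 φ) (hψ : ContDiff ℝ 1 ψ) (j : Fin 3) :
    partialL2 (φ - ψ) (hφ.sub hψ) j = partialL2 φ hφ j - partialL2 ψ hψ j := by
  have hs : ContDiff ℝ 1 (φ - ψ) := hφ.sub hψ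
  refine Lp.ext ?_
  filter_upwards [coeFn_partialL2 hs j, coeFn_partialL2 hφ j, coeFn_partialL2 hψ j,
    Lp.coeFn_sub (partialL2 φ hφ j) (partialL2 ψ hψ j)] with x h1 h2 h3 h4
  rw [h1, h4, Pi.sub_apply, h2, h3, fderiv_sub (hφ.differentiable one_ne_zero).differentiableAt
    (hψ.differentiable one_ne_zero).differentiableAt, sub_apply]

/-- If the transporting velocity is bounded by `M`, the transport term is controlled by the `L²`
norm of the gradient of the test field. -/
lemma abs_transport_toL2_le {U : E3 → E3} (hU : Continuous U) {M : ℝ} (hM : ∀ x, ‖U x‖ ≤ M)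
    {φ : E3 → E3} (hφ : ContDiff ℝ 1 φ) (v : L2) :
    |transport (toL2 U hU) v φ| ≤ M * (∑ j, ‖partialL2 φ hφ j‖) * ‖v‖ := by
  have hM0 : 0 ≤ M := (norm_nonneg _).trans (hM 0)
  have hae : ∀ᵐ x ∂(volume.restrict box), ‖⟪fderiv ℝ φ x (toL2 U hU x), v x⟫‖
      ≤ ∑ j, M * (‖partialL2 φ hφ j x‖ * ‖v x‖) := by
    filter_upwards [coeFn_toL2 hU, coeFn_partialL2 hφ 0, coeFn_partialL2 hφ 1,
      coeFn_partialL2 hφ 2] with x hx h0 h1 h2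
    have hj : ∀ j, partialL2 φ hφ j x = fderiv ℝ φ x (e j) := by
      intro j
      fin_cases j
      exacts [h0, h1, h2]
    refine (norm_inner_le_norm _ _).trans ?_
    simp_rw [hj, hx, ← mul_assoc]
    rw [← Finset.sum_mul]
    refine mul_le_mul_of_nonneg_right ?_ (norm_nonneg _)
    conv_lhs => rw [← sum_smul_e (U x), map_sum]
    refine norm_sum_le_of_le _ fun j _ => ?_
    rw [map_smul, norm_smul]
    exact mul_le_mul_of_nonneg_right ((PiLp.norm_apply_le (U x) j).trans (hM x)) (norm_nonneg _)
  have hi : ∀ j, Integrable (fun x => M * (‖partialL2 φ hφ j x‖ * ‖v x‖)) (volume.restrict box) :=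
    fun j => (integrable_norm_mul_norm _ _).const_mul M
  refine (norm_integral_le_of_norm_le (integrable_finsetSum _ fun j _ => hi j) hae).trans ?_
  rw [integral_finsetSum _ fun j _ => hi j, mul_assoc, Finset.sum_mul, Finset.mul_sum]
  refine Finset.sum_le_sum fun j _ => ?_
  rw [integral_const_mul]
  exact mul_le_mul_of_nonneg_left (setIntegral_norm_mul_norm_le _ _) hM0

/-! ### Truncated Fourier multipliers -/

/-- The wave vectors whose components are bounded by `n`. -/
def modes (n : ℕ) : Finset (Fin 3 → ℤ) := Finset.Icc (fun _ => -(n : ℤ)) fun _ => (n : ℤ)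

lemma neg_mem_modes {n : ℕ} {k : Fin 3 → ℤ} : -k ∈ modes n ↔ k ∈ modes n := by
  simp only [modes, Finset.mem_Icc, Pi.le_def, Pi.neg_apply]
  constructor
  · rintro ⟨h1, h2⟩
    exact ⟨fun i => by linarith [h2 i], fun i => by linarith [h1 i]⟩
  · rintro ⟨h1, h2⟩
    exact ⟨fun i => by linarith [h2 i], fun i => by linarith [h1 i]⟩

lemma tendsto_modes : Filter.Tendsto modes Filter.atTop Filter.atTop := by
  refine Filter.tendsto_atTop_finset_of_monotone (fun m n hmn => ?_) fun k => ?_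
  · refine Finset.Icc_subset_Icc (fun _ => ?_) (fun _ => ?_) <;> simpa using hmn
  · refine ⟨∑ i, (k i).natAbs, ?_⟩
    have h : ∀ i, (k i).natAbs ≤ ∑ i, (k i).natAbs := fun i =>
      Finset.single_le_sum (f := fun i => (k i).natAbs) (fun _ _ => Nat.zero_le _)
        (Finset.mem_univ i)
    simp only [modes, Finset.mem_Icc, Pi.le_def]
    exact ⟨fun i => by have := h i; omega, fun i => by have := h i; omega⟩

lemma sum_modes_neg {M : Type*} [AddCommMonoid M] (n : ℕ) (f : (Fin 3 → ℤ) → M) :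
    ∑ k ∈ modes n, f (-k) = ∑ k ∈ modes n, f k :=
  Finset.sum_nbij' (fun k => -k) (fun k => -k) (fun _ h => neg_mem_modes.2 h)
    (fun _ h => neg_mem_modes.2 h) (fun _ _ => neg_neg _) (fun _ _ => neg_neg _) fun _ _ => rfl

/-- The trigonometric polynomial with amplitudes `a k` for `k ∈ modes n`. -/
def trigPoly (n : ℕ) (a : (Fin 3 → ℤ) → E3) (x : E3) : E3 := ∑ k ∈ modes n, hart k x • a k

lemma contDiff_trigPoly (n : ℕ) (a : (Fin 3 → ℤ) → E3) {m : WithTop ℕ∞} :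
    ContDiff ℝ m (trigPoly n a) :=
  ContDiff.sum fun k _ => (contDiff_hart k).smul contDiff_const

lemma isPeriodic_trigPoly (n : ℕ) (a : (Fin 3 → ℤ) → E3) : IsPeriodic (trigPoly n a) := by
  intro j x
  simp only [trigPoly, isPeriodic_hart _ j x]

lemma continuous_trigPoly (n : ℕ) (a : (Fin 3 → ℤ) → E3) : Continuous (trigPoly n a) :=
  (contDiff_trigPoly n a (m := 0)).continuous

lemma toL2_trigPoly (n : ℕ) (a : (Fin 3 → ℤ) → E3) :
    toL2 (trigPoly n a) (continuous_trigPoly n a) = ∑ k ∈ modes n, mode k (a k) := by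
  refine hat_injective fun l => ?_
  rw [hat_toL2, map_sum]
  simp only [trigPoly, Finset.smul_sum, smul_smul, hat_mode]
  rw [integral_finsetSum _ fun k _ => by
    exact (((continuous_hart l).mul (continuous_hart k)).smul
      continuous_const).continuousOn.integrableOn_compact isCompact_box]
  refine Finset.sum_congr rfl fun k _ => ?_
  rw [integral_smul_const, setIntegral_hart_mul_hart]
  split_ifs <;> simp

lemma fderiv_trigPoly (n : ℕ) (a : (Fin 3 → ℤ) → E3) (x : E3) (j : Fin 3) :
    fderiv ℝ (trigPoly n a) x (e j) = trigPoly n (fun k => -((k j : ℝ) • a (-k))) x := by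
  have h : HasFDerivAt (trigPoly n a)
      (∑ k ∈ modes n, (fderiv ℝ (hart k) x).smulRight (a k)) x :=
    HasFDerivAt.fun_sum fun k _ =>
      ((contDiff_hart k (n := 1)).differentiable
        one_ne_zero).differentiableAt.hasFDerivAt.smul_const _
  rw [h.fderiv, sum_apply, trigPoly, ← sum_modes_neg]
  refine Finset.sum_congr rfl fun k _ => ?_
  rw [ContinuousLinearMap.smulRight_apply, fderiv_hart, inner_freq_e]
  simp only [neg_neg, Pi.neg_apply, Int.cast_neg]
  rw [mul_comm, mul_smul, neg_smul]

/-- The Fourier multiplier with symbol `σ`, truncated to the wave vectors in `modes n`. -/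
def multiplier (n : ℕ) (σ : (Fin 3 → ℤ) → E3 →L[ℝ] E3) : L2 →L[ℝ] L2 :=
  ∑ k ∈ modes n, (mode k).toContinuousLinearMap ∘L σ k ∘L hat k

lemma multiplier_apply (n : ℕ) (σ : (Fin 3 → ℤ) → E3 →L[ℝ] E3) (v : L2) :
    multiplier n σ v = ∑ k ∈ modes n, mode k (σ k (hat k v)) := by
  simp [multiplier]

lemma multiplier_eq_toL2 (n : ℕ) (σ : (Fin 3 → ℤ) → E3 →L[ℝ] E3) (v : L2) :
    multiplier n σ v = toL2 (trigPoly n fun k => σ k (hat k v)) (continuous_trigPoly n _) := by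
  rw [multiplier_apply, toL2_trigPoly]

lemma hat_multiplier (n : ℕ) (σ : (Fin 3 → ℤ) → E3 →L[ℝ] E3) (v : L2) (l : Fin 3 → ℤ) :
    hat l (multiplier n σ v) = if l ∈ modes n then σ l (hat l v) else 0 := by
  simp [multiplier_apply, hat_mode]

lemma norm_multiplier_le (n : ℕ) {σ : (Fin 3 → ℤ) → E3 →L[ℝ] E3} (hσ : ∀ k a, ‖σ k a‖ ≤ ‖a‖)
    (v : L2) : ‖multiplier n σ v‖ ≤ ‖v‖ := by
  refine (sq_le_sq₀ (norm_nonneg _) (norm_nonneg _)).1 ?_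
  refine hasSum_le (fun k => ?_) (hasSum_norm_hat_sq _) (hasSum_norm_hat_sq v)
  rw [hat_multiplier]
  split_ifs
  · gcongr
    exact hσ _ _
  · simp

/-- The symbol of the Leray projector followed by the filter `(1 - αΔ)⁻¹`. -/
def filterLeray (α : ℝ) (k : Fin 3 → ℤ) : E3 →L[ℝ] E3 := filterSymbol α k • leray k

lemma filterLeray_apply (α : ℝ) (k : Fin 3 → ℤ) (a : E3) :
    filterLeray α k a = filterSymbol α k • leray k a := rfl

lemma multiplier_filterLeray_mem_H (n : ℕ) (α : ℝ) (v : L2) :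
    multiplier n (filterLeray α) v ∈ H := by
  refine mem_H_iff.2 fun k => ?_
  rw [hat_multiplier]
  split_ifs <;> simp [filterLeray_apply]

/-- Truncations of a filtered field are bounded, uniformly in the truncation: this is the embedding
of `H²` into the bounded functions. -/
lemma exists_bound_filtered {α : ℝ} (hα : 0 < α) : ∃ C, 0 ≤ C ∧ ∀ (n : ℕ) (v : L2) (x : E3),
    ‖trigPoly n (fun k => filterLeray α k (hat k v)) x‖ ≤ C * ‖v‖ := by
  have hs := summable_filterSymbol_sq hα
  refine ⟨2 * normConst * √(∑' k, filterSymbol α k ^ 2), ?_, fun n v x => ?_⟩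
  · have := normConst_pos; positivity
  · have h1 : ‖trigPoly n (fun k => filterLeray α k (hat k v)) x‖
        ≤ ∑ k ∈ modes n, 2 * normConst * (filterSymbol α k * ‖hat k v‖) := by
      refine norm_sum_le_of_le _ fun k _ => ?_
      rw [norm_smul]
      refine mul_le_mul (abs_hart_le k x) ?_ (norm_nonneg _) (by have := normConst_pos; positivity)
      simp only [filterLeray_apply, norm_smul, Real.norm_of_nonneg (filterSymbol_nonneg hα k)]
      exact mul_le_mul_of_nonneg_left (norm_leray_le _ _) (filterSymbol_nonneg hα k)
    refine h1.trans ?_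
    rw [← Finset.mul_sum, mul_assoc (2 * normConst) (√_)]
    refine mul_le_mul_of_nonneg_left ?_ (mul_nonneg zero_le_two normConst_pos.le)
    refine (Real.sum_mul_le_sqrt_mul_sqrt _ _ _).trans ?_
    have h2 : ∑ k ∈ modes n, filterSymbol α k ^ 2 ≤ ∑' k, filterSymbol α k ^ 2 :=
      hs.sum_le_tsum _ fun k _ => sq_nonneg (filterSymbol α k)
    have h3 : ∑ k ∈ modes n, ‖hat k v‖ ^ 2 ≤ ‖v‖ ^ 2 :=
      sum_le_hasSum _ (fun _ _ => sq_nonneg _) (hasSum_norm_hat_sq v)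
    gcongr
    exact Real.sqrt_le_iff.2 ⟨norm_nonneg _, h3⟩

/-! ### The Galerkin approximation of the nonlinearity -/

lemma contDiff_hart_smul (k : Fin 3 → ℤ) (a : E3) {m : WithTop ℕ∞} :
    ContDiff ℝ m fun x => hart k x • a := (contDiff_hart k).smul contDiff_const

/-- The Galerkin approximation of the nonlinearity of the Leray-α model: the bilinear map whose
value at `(u, v)` is characterized by `inner_galerkin`. The velocity `u` is projected onto the
divergence free trigonometric polynomials with frequencies in `modes n` and filtered, `v` and the
result are projected. -/
def galerkin (α : ℝ) (n : ℕ) : L2 →L[ℝ] L2 →L[ℝ] L2 :=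
  ∑ p ∈ modes n ×ˢ (Finset.univ : Finset (Fin 3)),
    (ContinuousLinearMap.compL ℝ L2 ℝ L2
      (ContinuousLinearMap.toSpanSingleton ℝ (mode p.1 (e p.2)))).comp
      ((transportForm _ (contDiff_hart_smul p.1 (leray p.1 (e p.2)))).bilinearComp
        (multiplier n (filterLeray α)) (multiplier n leray))

lemma inner_galerkin (α : ℝ) (n : ℕ) (u v w : L2) : ⟪galerkin α n u v, w⟫
    = transport (multiplier n (filterLeray α) u) (multiplier n leray v)
        (trigPoly n fun k => leray k (hat k w)) := by
  have h : (trigPoly n fun k => leray k (hat k w)) = fun x =>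
      ∑ p ∈ modes n ×ˢ (Finset.univ : Finset (Fin 3)),
        ⟪e p.2, hat p.1 w⟫ • (hart p.1 x • leray p.1 (e p.2)) := by
    funext x
    rw [Finset.sum_product, trigPoly]
    refine Finset.sum_congr rfl fun k _ => ?_
    simp_rw [smul_comm _ (hart k x), ← Finset.smul_sum]
    conv_lhs => rw [← sum_smul_e (hat k w)]
    simp [EuclideanSpace.inner_single_left]
  rw [h, transport_sum_smul (modes n ×ˢ (Finset.univ : Finset (Fin 3)))
    (fun p => ⟪e p.2, hat p.1 w⟫) (φ := fun p x => hart p.1 x • leray p.1 (e p.2))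
    (fun p => contDiff_hart_smul p.1 (leray p.1 (e p.2)))]
  simp only [galerkin, sum_apply, sum_inner]
  refine Finset.sum_congr rfl fun p _ => ?_
  simp [real_inner_smul_left, inner_mode_left, mul_comm]

/-- Transport of a smooth field by a divergence free velocity does not change its energy: the
integrand is the derivative of `|F|²/2` along the velocity. -/
lemma transport_toL2_self {F : E3 → E3} (hF : ContDiff ℝ ∞ F) (hp : IsPeriodic F) {u : L2}
    (hu : u ∈ H) : transport u (toL2 F hF.continuous) F = 0 := by
  have hq : IsSmoothPeriodic fun x => ⟪F x, F x⟫ / 2 :=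
    ⟨(hF.inner ℝ hF).div_const 2, fun j x => by simp only [hp j x]⟩
  rw [← hu.2 _ hq]
  refine integral_congr_ae ?_
  filter_upwards [coeFn_toL2 hF.continuous] with x hx
  have hd : HasFDerivAt F (fderiv ℝ F x) x :=
    (hF.differentiable (by simp)).differentiableAt.hasFDerivAt
  have h2 := ((hd.inner ℝ hd).const_mul (2⁻¹ : ℝ)).fderiv
  have h3 : (fun x => ⟪F x, F x⟫ / 2) = fun x => 2⁻¹ * ⟪F x, F x⟫ := by
    funext x; ring
  rw [real_inner_comm (∇ _ x), gradient, InnerProductSpace.toDual_symm_apply, h3, h2, hx]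
  simp only [smul_apply, ContinuousLinearMap.comp_apply, ContinuousLinearMap.prod_apply,
    fderivInnerCLM_apply, smul_eq_mul]
  rw [real_inner_comm (F x)]
  ring

/-- Conservation of energy for the Galerkin approximations. -/
lemma inner_galerkin_self (α : ℝ) (n : ℕ) (v : L2) : ⟪galerkin α n v v, v⟫ = 0 := by
  rw [inner_galerkin, multiplier_eq_toL2 n leray v]
  exact transport_toL2_self (contDiff_trigPoly n _) (isPeriodic_trigPoly n _)
    (multiplier_filterLeray_mem_H n α v)

/-- Truncation commutes with weak differentiation. -/
lemma partialL2_trigPoly_leray {w g : L2} {j : Fin 3} (h : IsWeakPartial j w g) (n : ℕ) :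
    partialL2 (trigPoly n fun k => leray k (hat k w)) (contDiff_trigPoly n _) j
      = multiplier n leray g := by
  rw [multiplier_eq_toL2, partialL2]
  congr 1
  funext x
  rw [fderiv_trigPoly]
  congr 1
  funext k
  rw [h.hat_eq k, leray_neg, map_neg, map_smul]

/-- The Galerkin nonlinearities are bounded in the dual of `V`, uniformly in the truncation. -/
lemma exists_bound_galerkin {α : ℝ} (hα : 0 < α) : ∃ C, 0 ≤ C ∧ ∀ (n : ℕ) (v w : L2)
    (g : Fin 3 → L2), (∀ j, IsWeakPartial j w (g j)) →
      |⟪galerkin α n v v, w⟫| ≤ C * ‖v‖ ^ 2 * ∑ j, ‖g j‖ := by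
  obtain ⟨C, hC0, hC⟩ := exists_bound_filtered hα
  refine ⟨C, hC0, fun n v w g hg => ?_⟩
  rw [inner_galerkin, multiplier_eq_toL2 n (filterLeray α)]
  refine (abs_transport_toL2_le _ (hC n v) (contDiff_trigPoly n _) _).trans ?_
  have h1 : ∀ j, ‖partialL2 (trigPoly n fun k => leray k (hat k w)) (contDiff_trigPoly n _) j‖
      ≤ ‖g j‖ := fun j => by
    rw [partialL2_trigPoly_leray (hg j)]
    exact norm_multiplier_le n norm_leray_le _
  calc _ ≤ C * ‖v‖ * (∑ j, ‖g j‖) * ‖v‖ := by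
        gcongr
        · exact h1 _
        · exact norm_multiplier_le n norm_leray_le _
    _ = _ := by ring

/-! ### Quadratic differential equations that conserve the norm -/

/-- A differential equation `v' = B(v, v)` whose right-hand side is orthogonal to `v` has global
solutions, and they have constant norm. -/
lemma exists_forall_hasDerivWithinAt_of_inner_eq_zero {X : Type*} [NormedAddCommGroup X]
    [InnerProductSpace ℝ X] [CompleteSpace X] (B : X →L[ℝ] X →L[ℝ] X)
    (hB : ∀ v, ⟪B v v, v⟫ = 0) (x₀ : X) {T : ℝ} (hT : 0 ≤ T) :
    ∃ v : ℝ → X, v 0 = x₀ ∧ (∀ t ∈ Icc 0 T, ‖v t‖ = ‖x₀‖) ∧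
      ∀ t ∈ Icc 0 T, HasDerivWithinAt v (B (v t) (v t)) (Icc 0 T) t := by
  -- The factor makes the vector field bounded and equals `1` on the sphere that contains `x₀`.
  let g : X → ℝ := fun v => (1 + ‖x₀‖ ^ 2) * (1 + ‖v‖ ^ 2)⁻¹
  let f : X → X := fun v => g v • B v v
  have hg0 : ∀ v, 0 ≤ g v := fun v => by positivity
  have hquad : ∀ v, ‖B v v‖ ≤ ‖B‖ * ‖v‖ ^ 2 := fun v => by
    simpa only [sq, mul_assoc] using B.le_opNorm₂ v v
  let L : NNReal := ⟨(1 + ‖x₀‖ ^ 2) * ‖B‖, by positivity⟩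
  have hL : ∀ v, ‖f v‖ ≤ L := by
    intro v
    have h1 : (1 + ‖v‖ ^ 2)⁻¹ * ‖v‖ ^ 2 ≤ 1 := by
      rw [inv_mul_le_iff₀ (by positivity)]; linarith
    calc ‖f v‖ = g v * ‖B v v‖ := by rw [norm_smul, Real.norm_of_nonneg (hg0 v)]
      _ ≤ g v * (‖B‖ * ‖v‖ ^ 2) := mul_le_mul_of_nonneg_left (hquad v) (hg0 v)
      _ = (1 + ‖x₀‖ ^ 2) * ‖B‖ * ((1 + ‖v‖ ^ 2)⁻¹ * ‖v‖ ^ 2) := by simp only [g]; ring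
      _ ≤ (1 + ‖x₀‖ ^ 2) * ‖B‖ * 1 := mul_le_mul_of_nonneg_left h1 (by positivity)
      _ = L := mul_one _
  let a : NNReal := L * ⟨T, hT⟩
  let ρ : ℝ := ‖x₀‖ + a
  have hρ0 : 0 ≤ ρ := by positivity
  have hρ : ∀ v ∈ Metric.closedBall x₀ (a : ℝ), ‖v‖ ≤ ρ := fun v hv => by
    have := norm_le_norm_add_norm_sub' v x₀
    rw [Metric.mem_closedBall, dist_eq_norm] at hv
    linarith
  let K : NNReal := ⟨(1 + ‖x₀‖ ^ 2) * (2 * ρ * ‖B‖ + 2 * ρ * (‖B‖ * ρ ^ 2)), by positivity⟩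
  have hK : LipschitzOnWith K f (Metric.closedBall x₀ (a : ℝ)) := by
    refine LipschitzOnWith.of_dist_le_mul fun v hv w hw => ?_
    have hv := hρ v hv
    have hw := hρ w hw
    have hsq : ‖B v v - B w w‖ ≤ 2 * ρ * ‖B‖ * ‖v - w‖ := by
      have h1 : B v v - B w w = B (v - w) v + B w (v - w) := by
        simp only [map_sub, sub_apply]; abel
      rw [h1]
      calc _ ≤ ‖B‖ * ‖v - w‖ * ‖v‖ + ‖B‖ * ‖w‖ * ‖v - w‖ :=
            norm_add_le_of_le (B.le_opNorm₂ _ _) (B.le_opNorm₂ _ _)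
        _ ≤ ‖B‖ * ‖v - w‖ * ρ + ‖B‖ * ρ * ‖v - w‖ := by gcongr
        _ = _ := by ring
    have hdiff : |(1 + ‖v‖ ^ 2)⁻¹ - (1 + ‖w‖ ^ 2)⁻¹| ≤ 2 * ρ * ‖v - w‖ := by
      rw [inv_sub_inv (by positivity) (by positivity), abs_div]
      have h2 : |(1 + ‖w‖ ^ 2) - (1 + ‖v‖ ^ 2)| ≤ 2 * ρ * ‖v - w‖ := by
        have h3 : (1 + ‖w‖ ^ 2) - (1 + ‖v‖ ^ 2) = (‖w‖ + ‖v‖) * (‖w‖ - ‖v‖) := by ring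
        rw [h3, abs_mul, abs_of_nonneg (by positivity), norm_sub_rev]
        exact mul_le_mul (by linarith) (abs_norm_sub_norm_le _ _) (abs_nonneg _) (by positivity)
      refine (div_le_self (abs_nonneg _) ?_).trans h2
      rw [abs_of_nonneg (by positivity)]
      nlinarith [sq_nonneg ‖v‖, sq_nonneg ‖w‖, mul_nonneg (sq_nonneg ‖v‖) (sq_nonneg ‖w‖)]
    have hinv : |(1 + ‖v‖ ^ 2)⁻¹| ≤ 1 := by
      rw [abs_of_nonneg (by positivity)]
      exact inv_le_one_of_one_le₀ (by nlinarith [sq_nonneg ‖v‖])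
    rw [dist_eq_norm, dist_eq_norm]
    have h4 : f v - f w = (1 + ‖x₀‖ ^ 2) • ((1 + ‖v‖ ^ 2)⁻¹ • (B v v - B w w)
        + ((1 + ‖v‖ ^ 2)⁻¹ - (1 + ‖w‖ ^ 2)⁻¹) • B w w) := by
      simp only [f, g, smul_sub, sub_smul, smul_add, mul_smul]; abel
    rw [h4, norm_smul, Real.norm_of_nonneg (by positivity)]
    calc _ ≤ (1 + ‖x₀‖ ^ 2) * (1 * (2 * ρ * ‖B‖ * ‖v - w‖)
          + 2 * ρ * ‖v - w‖ * (‖B‖ * ρ ^ 2)) := by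
          refine mul_le_mul_of_nonneg_left (norm_add_le_of_le ?_ ?_) (by positivity)
          · rw [norm_smul]
            exact mul_le_mul hinv hsq (norm_nonneg _) zero_le_one
          · rw [norm_smul]
            refine mul_le_mul hdiff ((hquad w).trans ?_) (norm_nonneg _) (by positivity)
            gcongr
      _ = (1 + ‖x₀‖ ^ 2) * (2 * ρ * ‖B‖ + 2 * ρ * (‖B‖ * ρ ^ 2)) * ‖v - w‖ := by ring
  have hPL : IsPicardLindelof (fun _ => f) (tmin := 0) (tmax := T) ⟨0, le_rfl, hT⟩ x₀ a 0 L K :=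
    IsPicardLindelof.of_time_independent (fun v _ => hL v) hK (by
      simp only [sub_zero, sub_self, max_eq_left hT, NNReal.coe_zero]
      exact le_of_eq rfl)
  obtain ⟨v, hv0, hv⟩ := hPL.exists_eq_forall_mem_Icc_hasDerivWithinAt₀
  have hnorm : ∀ t ∈ Icc 0 T, ‖v t‖ = ‖x₀‖ := by
    intro t ht
    have h := constant_of_has_deriv_right_zero (f := fun t => ‖v t‖ ^ 2) (a := 0) (b := T)
      (fun t ht => ((hv t ht).continuousWithinAt.norm.pow 2)) (fun t ht => by
        have h1 := (hv t (Ico_subset_Icc_self ht)).norm_sq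
        have h2 : 2 * ⟪v t, f (v t)⟫ = 0 := by
          simp only [f]
          rw [real_inner_smul_right, real_inner_comm, hB]
          simp
        rw [h2] at h1
        exact h1.mono_of_mem_nhdsWithin (Icc_mem_nhdsGE_of_mem ht)) t ht
    simp only [hv0] at h
    exact (sq_eq_sq₀ (norm_nonneg _) (norm_nonneg _)).1 h
  refine ⟨v, hv0, hnorm, fun t ht => ?_⟩
  have h1 : f (v t) = B (v t) (v t) := by
    have : g (v t) = 1 := by
      simp only [g, hnorm t ht]
      exact mul_inv_cancel₀ (by positivity)
    simp only [f, this, one_smul]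
  exact h1 ▸ hv t ht

/-! ### Compactness -/

/-- A sequence of countable families of functions on a compact space, uniformly bounded and
uniformly Lipschitz for each index, has a subsequence that converges for all indices. -/
lemma exists_subseq_tendsto_of_lipschitz {ι α β : Type*} [Countable ι] [MetricSpace α]
    [CompactSpace α] [NormedAddCommGroup β] [ProperSpace β] {R : ℝ} {L : ι → NNReal}
    {a : ℕ → ι → α → β} (hR : ∀ n i t, ‖a n i t‖ ≤ R) (hL : ∀ n i, LipschitzWith (L i) (a n i)) :
    ∃ (θ : ℕ → ℕ) (f : ι → α → β), StrictMono θ ∧ (∀ i, LipschitzWith (L i) (f i)) ∧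
      ∀ i t, Filter.Tendsto (fun n => a (θ n) i t) Filter.atTop (nhds (f i t)) := by
  let A : ι → Set (BoundedContinuousFunction α β) := fun i =>
    {f | (∀ t, f t ∈ Metric.closedBall (0 : β) R) ∧ LipschitzWith (L i) f}
  have hA : ∀ i, IsCompact (A i) := by
    intro i
    refine BoundedContinuousFunction.arzela_ascoli₂ (Metric.closedBall (0 : β) R)
      (isCompact_closedBall _ _) (A i) ?_ (fun f t hf => hf.1 t) ?_
    · have h1 : A i = (⋂ t, {f | f t ∈ Metric.closedBall (0 : β) R}) ∩
          ⋂ s, ⋂ t, {f | dist (f s) (f t) ≤ L i * dist s t} := by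
        ext f
        simp [A, lipschitzWith_iff_dist_le_mul]
      rw [h1]
      refine (isClosed_iInter fun t => ?_).inter
        (isClosed_iInter fun s => isClosed_iInter fun t => ?_)
      · exact Metric.isClosed_closedBall.preimage (continuous_eval_const t)
      · exact isClosed_le ((continuous_eval_const s).dist (continuous_eval_const t))
          continuous_const
    · exact (LipschitzWith.uniformEquicontinuous _ (L i) fun f => f.2.2).equicontinuous
  let b : ℕ → ι → BoundedContinuousFunction α β := fun n i =>
    BoundedContinuousFunction.mkOfCompact ⟨a n i, (hL n i).continuous⟩
  obtain ⟨f, hf, θ, hθ, hlim⟩ := (isCompact_univ_pi hA).tendsto_subseq (x := b) fun n i _ =>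
    ⟨fun t => by simpa [b] using hR n i t, hL n i⟩
  refine ⟨θ, fun i => f i, hθ, fun i => (hf i trivial).2, fun i t => ?_⟩
  exact ((continuous_eval_const t).tendsto _).comp
    ((tendsto_pi_nhds.1 hlim) i)

/-! ### Passage to the limit in the nonlinearity -/

/-- The test element is approximated by a finite part of its Fourier series, for which convergence
of the coefficients suffices. -/
lemma tendsto_inner_zero_of_hat {z : ℕ → L2} {R : ℝ} (hR : ∀ n, ‖z n‖ ≤ R)
    (h : ∀ k, Filter.Tendsto (fun n => hat k (z n)) Filter.atTop (nhds 0)) (x : L2) :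
    Filter.Tendsto (fun n => ⟪z n, x⟫) Filter.atTop (nhds 0) := by
  have hR0 : 0 ≤ R := (norm_nonneg _).trans (hR 0)
  rw [Metric.tendsto_nhds]
  intro ε hε
  have hx := (hasSum_mode_hat x).eventually (Metric.ball_mem_nhds x
    (show 0 < ε / (2 * (R + 1)) by positivity))
  obtain ⟨s, hs⟩ := hx.exists
  rw [dist_comm, dist_eq_norm] at hs
  have h1 : Filter.Tendsto (fun n => ⟪z n, ∑ k ∈ s, mode k (hat k x)⟫) Filter.atTop (nhds 0) := by
    simp_rw [inner_sum, real_inner_comm (mode _ _), inner_mode_left]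
    have h0 := tendsto_finsetSum s fun k _ =>
      (tendsto_const_nhds (x := hat k x)).inner (𝕜 := ℝ) (h k)
    simpa only [inner_zero_right, Finset.sum_const_zero] using h0
  filter_upwards [(Metric.tendsto_nhds.1 h1) (ε / 2) (by positivity)] with n hn
  rw [dist_zero_right] at hn ⊢
  have h2 : ⟪z n, x⟫ = ⟪z n, ∑ k ∈ s, mode k (hat k x)⟫
      + ⟪z n, x - ∑ k ∈ s, mode k (hat k x)⟫ := by
    rw [← inner_add_right]; congr 1; abel
  rw [h2]
  have h3 : ‖⟪z n, x - ∑ k ∈ s, mode k (hat k x)⟫‖ ≤ (R + 1) * (ε / (2 * (R + 1))) :=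
    (norm_inner_le_norm _ _).trans
      (mul_le_mul ((hR n).trans (by linarith)) hs.le (norm_nonneg _) (by positivity))
  have h4 : (R + 1) * (ε / (2 * (R + 1))) = ε / 2 := by
    field_simp
  calc _ ≤ _ := norm_add_le _ _
    _ < ε / 2 + ε / 2 := by linarith
    _ = ε := add_halves ε

/-- Bounded sequences of fields whose Fourier coefficients converge are weakly convergent. -/
lemma tendsto_inner_of_hat {w : ℕ → L2} {v : L2} {R : ℝ} (hR : ∀ n, ‖w n‖ ≤ R)
    (h : ∀ k, Filter.Tendsto (fun n => hat k (w n)) Filter.atTop (nhds (hat k v))) (x : L2) :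
    Filter.Tendsto (fun n => ⟪w n, x⟫) Filter.atTop (nhds ⟪v, x⟫) := by
  have h1 := tendsto_inner_zero_of_hat (z := fun n => w n - v) (R := R + ‖v‖)
    (fun n => (norm_sub_le _ _).trans (by linarith [hR n])) (fun k => by
      simpa using (h k).sub_const (hat k v)) x
  simpa [inner_sub_left] using h1.add_const ⟪v, x⟫

lemma tendsto_apply_of_hat {w : ℕ → L2} {v : L2} {R : ℝ} (hR : ∀ n, ‖w n‖ ≤ R)
    (h : ∀ k, Filter.Tendsto (fun n => hat k (w n)) Filter.atTop (nhds (hat k v)))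
    (f : L2 →L[ℝ] ℝ) : Filter.Tendsto (fun n => f (w n)) Filter.atTop (nhds (f v)) := by
  have h1 := tendsto_inner_of_hat hR h ((InnerProductSpace.toDual ℝ L2).symm f)
  simp_rw [real_inner_comm ((InnerProductSpace.toDual ℝ L2).symm f),
    InnerProductSpace.toDual_symm_apply] at h1
  exact h1

lemma tendsto_hat_multiplier {θ : ℕ → ℕ} (hθ : Filter.Tendsto θ Filter.atTop Filter.atTop)
    (σ : (Fin 3 → ℤ) → E3 →L[ℝ] E3) {w : ℕ → L2} {v : L2} {k : Fin 3 → ℤ}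
    (h : Filter.Tendsto (fun n => hat k (w n)) Filter.atTop (nhds (hat k v))) :
    Filter.Tendsto (fun n => hat k (multiplier (θ n) σ (w n))) Filter.atTop
      (nhds (σ k (hat k v))) := by
  refine (((σ k).continuous.tendsto _).comp h).congr' ?_
  have h1 := (tendsto_modes.comp hθ).eventually (Filter.eventually_ge_atTop {k})
  filter_upwards [h1] with n hn
  have hk : k ∈ modes (θ n) := Finset.singleton_subset_iff.1 hn
  rw [hat_multiplier, if_pos hk]
  rfl

lemma tendsto_multiplier_leray {g : L2} (hg : g ∈ H) :
    Filter.Tendsto (fun n => multiplier n leray g) Filter.atTop (nhds g) := by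
  refine ((hasSum_mode_hat g).comp tendsto_modes).congr fun n => ?_
  rw [multiplier_apply]
  exact Finset.sum_congr rfl fun k _ => by rw [mem_H_iff.1 hg k]

/-- Compactness of the filter: it turns weak convergence into strong convergence, since its symbol
is square summable. -/
lemma tendsto_multiplier_filterLeray {α : ℝ} (hα : 0 < α) {θ : ℕ → ℕ}
    (hθ : Filter.Tendsto θ Filter.atTop Filter.atTop) {w : ℕ → L2} {v u : L2} {R : ℝ}
    (hR : ∀ n, ‖w n‖ ≤ R)
    (h : ∀ k, Filter.Tendsto (fun n => hat k (w n)) Filter.atTop (nhds (hat k v)))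
    (hu : ∀ k, hat k u = filterLeray α k (hat k v)) :
    Filter.Tendsto (fun n => multiplier (θ n) (filterLeray α) (w n)) Filter.atTop (nhds u) := by
  have hle : ∀ k (x : L2), ‖filterLeray α k (hat k x)‖ ≤ filterSymbol α k * ‖x‖ := fun k x => by
    rw [filterLeray_apply, norm_smul, Real.norm_of_nonneg (filterSymbol_nonneg hα k)]
    exact mul_le_mul_of_nonneg_left ((norm_leray_le _ _).trans (norm_hat_le _ _))
      (filterSymbol_nonneg hα k)
  have hR0 : 0 ≤ R := (norm_nonneg _).trans (hR 0)
  have h1 : Filter.Tendsto (fun n => ∑' k, ‖hat k (multiplier (θ n) (filterLeray α) (w n) - u)‖ ^ 2)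
      Filter.atTop (nhds (∑' _ : Fin 3 → ℤ, (0 : ℝ))) := by
    refine tendsto_tsum_of_dominated_convergence
      (bound := fun k => filterSymbol α k ^ 2 * (R + ‖v‖) ^ 2)
      ((summable_filterSymbol_sq hα).mul_right _) (fun k => ?_)
      (Filter.Eventually.of_forall fun n k => ?_)
    · have h2 := ((tendsto_hat_multiplier hθ (filterLeray α) (h k)).sub_const (hat k u)).norm.pow 2
      simpa [hu k] using h2
    · rw [Real.norm_of_nonneg (by positivity), ← mul_pow]
      refine pow_le_pow_left₀ (norm_nonneg _) ?_ 2
      rw [map_sub, hat_multiplier, hu k, mul_add]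
      refine norm_sub_le_of_le ?_ (hle k v)
      split_ifs
      · exact (hle k _).trans (mul_le_mul_of_nonneg_left (hR n) (filterSymbol_nonneg hα k))
      · simpa using mul_nonneg (filterSymbol_nonneg hα k) hR0
  simp_rw [(hasSum_norm_hat_sq _).tsum_eq] at h1
  rw [tsum_zero] at h1
  rw [tendsto_iff_norm_sub_tendsto_zero]
  have h3 := h1.sqrt
  simpa [Real.sqrt_sq] using h3

/-- The derivatives of a test field are divergence free and have zero mean. -/
lemma IsTestField.partialL2_mem_H {φ : E3 → E3} (hφ : IsTestField φ) (j : Fin 3) :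
    partialL2 φ hφ.contDiff j ∈ H := by
  have hw : ∀ j, IsWeakPartial j (toL2 φ hφ.contDiff.continuous) (partialL2 φ hφ.contDiff j) :=
    fun j => isWeakPartial_toL2 hφ.contDiff hφ.periodic j
  refine mem_H_iff.2 fun k => ?_
  by_cases hk : k = 0
  · rw [(hw j).hat_eq k, hk]
    simp
  · refine leray_eq_self hk ?_
    have hc : ∀ i, Continuous fun x => fderiv ℝ φ x (e i) := fun i =>
      (hφ.contDiff.continuous_fderiv one_ne_zero).clm_apply continuous_const
    have h1 : ∑ i, hat k (partialL2 φ hφ.contDiff i) i = 0 := by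
      have h2 : ∀ i, hat k (partialL2 φ hφ.contDiff i) i
          = ∫ x in box, hart k x * fderiv ℝ φ x (e i) i := by
        intro i
        have hi : IntegrableOn (fun x => hart k x • fderiv ℝ φ x (e i)) box :=
          ((continuous_hart k).smul (hc i)).continuousOn.integrableOn_compact isCompact_box
        rw [partialL2, hat_toL2]
        exact ((EuclideanSpace.proj (𝕜 := ℝ) i).integral_comp_comm hi).symm
      have hi : ∀ i, IntegrableOn (fun x => hart k x * fderiv ℝ φ x (e i) i) box := fun i =>
        ((continuous_hart k).mul ((EuclideanSpace.proj (𝕜 := ℝ) i).continuous.comp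
          (hc i))).continuousOn.integrableOn_compact isCompact_box
      simp_rw [h2]
      rw [← integral_finsetSum _ fun i _ => hi i]
      simp_rw [← Finset.mul_sum, hφ.div_free, mul_zero, integral_zero]
    have h3 : ⟪freq k, hat (-k) (toL2 φ hφ.contDiff.continuous)⟫ = 0 := by
      simp_rw [(hw _).hat_eq k] at h1
      simpa [PiLp.inner_apply, mul_comm] using h1
    rw [(hw j).hat_eq k, inner_neg_right, real_inner_smul_right, h3]
    simp

/-- The Galerkin nonlinearities converge weakly along weakly convergent sequences. -/
lemma tendsto_inner_galerkin {α : ℝ} (hα : 0 < α) {θ : ℕ → ℕ}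
    (hθ : Filter.Tendsto θ Filter.atTop Filter.atTop) {w : ℕ → L2} {v u : L2} {R : ℝ}
    (hR : ∀ n, ‖w n‖ ≤ R) (hv : v ∈ H)
    (h : ∀ k, Filter.Tendsto (fun n => hat k (w n)) Filter.atTop (nhds (hat k v)))
    (hu : ∀ k, hat k u = filterLeray α k (hat k v)) {φ : E3 → E3} (hφ : IsTestField φ) :
    Filter.Tendsto (fun n => ⟪galerkin α (θ n) (w n) (w n), toL2 φ hφ.contDiff.continuous⟫)
      Filter.atTop (nhds (transport u v φ)) := by
  have hR0 : 0 ≤ R := (norm_nonneg _).trans (hR 0)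
  obtain ⟨C, hC0, hC⟩ := exists_bound_filtered hα
  set U := fun n => multiplier (θ n) (filterLeray α) (w n)
  set W := fun n => multiplier (θ n) leray (w n)
  set F := fun n => trigPoly (θ n) fun k => leray k (hat k (toL2 φ hφ.contDiff.continuous))
  have hF : ∀ n, ContDiff ℝ 1 (F n) := fun n => contDiff_trigPoly _ _
  have hFφ : ∀ n, ContDiff ℝ 1 (F n - φ) := fun n => (hF n).sub hφ.contDiff
  have hWR : ∀ n, ‖W n‖ ≤ R := fun n => (norm_multiplier_le _ norm_leray_le _).trans (hR n)
  have hU : Filter.Tendsto U Filter.atTop (nhds u) :=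
    tendsto_multiplier_filterLeray hα hθ hR h hu
  have hW : ∀ k, Filter.Tendsto (fun n => hat k (W n)) Filter.atTop (nhds (hat k v)) := by
    intro k
    have h1 := tendsto_hat_multiplier hθ leray (h k)
    rwa [mem_H_iff.1 hv k] at h1
  have hsplit : ∀ n, ⟪galerkin α (θ n) (w n) (w n), toL2 φ hφ.contDiff.continuous⟫
      = transport (U n) (W n) (F n - φ) + (transportForm φ hφ.contDiff (U n - u) (W n)
        + transportForm φ hφ.contDiff u (W n)) := by
    intro n
    rw [inner_galerkin, transport_sub (hF n) hφ.contDiff, map_sub, sub_apply]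
    simp only [transportForm_apply, U, W, F]
    ring
  simp_rw [hsplit]
  have hA : Filter.Tendsto (fun n => transport (U n) (W n) (F n - φ)) Filter.atTop (nhds 0) := by
    have hg : Filter.Tendsto (fun n => ∑ j, ‖partialL2 (F n - φ) (hFφ n) j‖)
        Filter.atTop (nhds (∑ _ : Fin 3, (0 : ℝ))) := by
      refine tendsto_finsetSum _ fun j _ => ?_
      have h1 := (tendsto_multiplier_leray (hφ.partialL2_mem_H j)).comp hθ
      refine ((tendsto_iff_norm_sub_tendsto_zero.1 h1)).congr fun n => ?_
      rw [partialL2_sub (hF n) hφ.contDiff, partialL2_trigPoly_leray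
        (isWeakPartial_toL2 hφ.contDiff hφ.periodic j)]
      rfl
    have hb := (hg.const_mul (C * R)).mul_const R
    simp only [Finset.sum_const_zero, mul_zero, zero_mul] at hb
    refine squeeze_zero_norm (fun n => ?_) hb
    have h2 := abs_transport_toL2_le (continuous_trigPoly (θ n) _) (hC (θ n) (w n))
      (hFφ n) (W n)
    rw [← multiplier_eq_toL2] at h2
    refine h2.trans ?_
    gcongr
    · exact hR n
    · exact hWR n
  have hB : Filter.Tendsto (fun n => transportForm φ hφ.contDiff (U n - u) (W n))
      Filter.atTop (nhds 0) := by
    have hb := ((tendsto_iff_norm_sub_tendsto_zero.1 hU).const_mul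
      ‖transportForm φ hφ.contDiff‖).mul_const R
    simp only [mul_zero, zero_mul] at hb
    refine squeeze_zero_norm (fun n => ?_) hb
    refine (ContinuousLinearMap.le_opNorm₂ _ _ _).trans ?_
    gcongr
    exact hWR n
  have hD := tendsto_apply_of_hat hWR hW (transportForm φ hφ.contDiff u)
  simpa using hA.add (hB.add hD)

/-! ### The approximate solutions -/

/-- The values of the approximate nonlinearity lie in `H`: testing it only sees the projected
amplitudes. -/
lemma galerkin_mem_H (α : ℝ) (n : ℕ) (u v : L2) : galerkin α n u v ∈ H := by
  refine mem_H_iff.2 fun k => ext_inner_left ℝ fun a => ?_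
  rw [← inner_leray_left, ← inner_mode_left, ← inner_mode_left, real_inner_comm,
    real_inner_comm (galerkin α n u v), inner_galerkin, inner_galerkin]
  congr 2
  funext l
  rw [hat_mode, hat_mode]
  split_ifs with h
  · rw [h, leray_leray]
  · rfl

lemma isWeakPartial_mode (j : Fin 3) (k : Fin 3 → ℤ) (a : E3) :
    IsWeakPartial j (mode k a) (mode (-k) ((k j : ℝ) • a)) := by
  have h := isWeakPartial_toL2 (contDiff_hart_smul k a)
    (fun i x => by simp only [isPeriodic_hart k i x]) j
  rw [mode_eq_toL2, mode_eq_toL2]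
  convert h using 2
  funext x
  have hd := (((contDiff_hart k (n := 1)).differentiable
    one_ne_zero).differentiableAt.hasFDerivAt (x := x)).smul_const a
  rw [hd.fderiv, ContinuousLinearMap.smulRight_apply, fderiv_hart, inner_freq_e, smul_smul,
    mul_comm]

/-- The properties of the Galerkin approximations on which the limit relies, for a constant `C`
that does not depend on the truncation. -/
structure IsApproxSolution (α T C : ℝ) (v₀ : L2) (n : ℕ) (v : ℝ → L2) : Prop where
  norm_eq : ∀ t ∈ Icc 0 T, ‖v t‖ = ‖v₀‖
  mem_H : ∀ t ∈ Icc 0 T, v t ∈ H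
  continuousOn : ContinuousOn v (Icc 0 T)
  inner_eq : ∀ w, ∀ t ∈ Icc 0 T,
    ⟪v t, w⟫ = ⟪v₀, w⟫ + ∫ s in (0 : ℝ)..t, ⟪galerkin α n (v s) (v s), w⟫
  abs_galerkin_le : ∀ (w : L2) (g : Fin 3 → L2), (∀ j, IsWeakPartial j w (g j)) →
    ∀ s ∈ Icc 0 T, |⟪galerkin α n (v s) (v s), w⟫| ≤ C * ∑ j, ‖g j‖
  abs_sub_le : ∀ (w : L2) (g : Fin 3 → L2), (∀ j, IsWeakPartial j w (g j)) →
    ∀ s ∈ Icc 0 T, ∀ t ∈ Icc 0 T, |⟪v t - v s, w⟫| ≤ C * (∑ j, ‖g j‖) * |t - s|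

/-- The quadratic equation `v' = galerkin α n v v` is solved in the whole of `L²`: the solution
stays in `H` because the amplitudes removed by the Leray projector are conserved. -/
lemma exists_isApproxSolution {α T : ℝ} (hα : 0 < α) (hT : 0 ≤ T) {v₀ : L2} (h₀ : v₀ ∈ H) :
    ∃ C, 0 ≤ C ∧ ∀ n, ∃ v, IsApproxSolution α T C v₀ n v := by
  obtain ⟨C, hC0, hC⟩ := exists_bound_galerkin hα
  refine ⟨C * ‖v₀‖ ^ 2, by positivity, fun n => ?_⟩
  obtain ⟨v, hv0, hnorm, hv⟩ := exists_forall_hasDerivWithinAt_of_inner_eq_zero (galerkin α n)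
    (inner_galerkin_self α n) v₀ hT
  have hcont : ContinuousOn v (Icc 0 T) := fun t ht => (hv t ht).continuousWithinAt
  have hd : ∀ w, ∀ t ∈ Icc 0 T, HasDerivWithinAt (fun s => ⟪v s, w⟫)
      ⟪galerkin α n (v t) (v t), w⟫ (Icc 0 T) t := fun w t ht => by
    simpa using (hv t ht).inner ℝ (hasDerivWithinAt_const t (Icc 0 T) w)
  have hlip : ∀ w M, (∀ t ∈ Icc 0 T, |⟪galerkin α n (v t) (v t), w⟫| ≤ M) →
      ∀ s ∈ Icc 0 T, ∀ t ∈ Icc 0 T, |⟪v t - v s, w⟫| ≤ M * |t - s| := by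
    intro w M hM s hs t ht
    rw [inner_sub_left]
    exact (convex_Icc 0 T).norm_image_sub_le_of_norm_hasDerivWithin_le (hd w) hM hs ht
  have hgc : ContinuousOn (fun s => galerkin α n (v s) (v s)) (Icc 0 T) :=
    ((galerkin α n).continuous.comp_continuousOn hcont).clm_apply hcont
  have hbd : ∀ (w : L2) (g : Fin 3 → L2), (∀ j, IsWeakPartial j w (g j)) →
      ∀ s ∈ Icc 0 T, |⟪galerkin α n (v s) (v s), w⟫| ≤ C * ‖v₀‖ ^ 2 * ∑ j, ‖g j‖ := by
    intro w g hg s hs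
    have h := hC n (v s) w g hg
    rwa [hnorm s hs] at h
  refine ⟨v, hnorm, fun t ht => ?_, hcont, fun w t ht => ?_, hbd,
    fun w g hg => hlip w _ (hbd w g hg)⟩
  -- The amplitude `hat k - leray k (hat k)` of the solution has derivative zero.
  · refine mem_H_iff.2 fun k => ?_
    rw [eq_comm, ← sub_eq_zero]
    refine ext_inner_left ℝ fun a => ?_
    have hin : ∀ x : L2, ⟪a, hat k x - leray k (hat k x)⟫ = ⟪x, mode k (a - leray k a)⟫ := by
      intro x
      rw [real_inner_comm (mode k _) x, inner_mode_left, inner_sub_left, inner_sub_right,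
        inner_leray_left]
    have h1 := hlip (mode k (a - leray k a)) 0 (fun t _ => by
      rw [← hin, mem_H_iff.1 (galerkin_mem_H α n _ _) k]
      simp) 0 ⟨le_rfl, hT⟩ t ht
    rw [zero_mul, abs_nonpos_iff, inner_sub_left, ← hin, ← hin, hv0, mem_H_iff.1 h₀ k] at h1
    simpa using h1
  · have hsub : Icc 0 t ⊆ Icc 0 T := Icc_subset_Icc_right ht.2
    have h := intervalIntegral.integral_eq_sub_of_hasDeriv_right_of_le ht.1
      (f := fun s => ⟪v s, w⟫) (f' := fun s => ⟪galerkin α n (v s) (v s), w⟫)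
      (fun s hs => ((hd w s (hsub hs)).continuousWithinAt.mono hsub))
      (fun s hs => (hd w s (hsub (Ioo_subset_Icc_self hs))).mono_of_mem_nhdsWithin
        (Icc_mem_nhdsGT_of_mem ⟨hs.1.le, hs.2.trans_le ht.2⟩))
      (((hgc.mono hsub).inner continuousOn_const).intervalIntegrable_of_Icc ht.1)
    rw [h, hv0]
    ring

lemma IsApproxSolution.norm_hat_sub_le {α T C : ℝ} {v₀ : L2} {n : ℕ} {v : ℝ → L2}
    (h : IsApproxSolution α T C v₀ n v) (hC : 0 ≤ C) (k : Fin 3 → ℤ) {s t : ℝ} (hs : s ∈ Icc 0 T)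
    (ht : t ∈ Icc 0 T) : ‖hat k (v t) - hat k (v s)‖ ≤ C * (∑ j, |(k j : ℝ)|) * |t - s| := by
  set z := hat k (v t) - hat k (v s) with hz
  have h1 := h.abs_sub_le (mode k z) _ (fun j => isWeakPartial_mode j k z) s hs t ht
  rw [real_inner_comm, inner_mode_left, map_sub, ← hz, real_inner_self_eq_norm_mul_norm,
    abs_of_nonneg (by positivity)] at h1
  simp only [LinearIsometry.norm_map, norm_smul, Real.norm_eq_abs] at h1
  rw [← Finset.sum_mul] at h1
  rcases (norm_nonneg z).eq_or_lt with h0 | h0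
  · rw [← h0]
    positivity
  · refine le_of_mul_le_mul_right (h1.trans_eq ?_) h0
    ring

/-! ### The weak solution -/

/-- Limits of the Galerkin approximations: along a subsequence, all Fourier coefficients converge at
all times. -/
lemma exists_limit {α T C : ℝ} (hT : 0 < T) (hC : 0 ≤ C) {v₀ : L2} {w : ℕ → ℝ → L2}
    (hw : ∀ n, IsApproxSolution α T C v₀ n (w n)) :
    ∃ (θ : ℕ → ℕ) (v : ℝ → L2), StrictMono θ ∧ (∀ t, ‖v t‖ ≤ ‖v₀‖) ∧ (∀ t, v t ∈ H) ∧
      (∀ k, Continuous fun t => hat k (v t)) ∧ ∀ t ∈ Icc 0 T, ∀ k,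
        Filter.Tendsto (fun n => hat k (w (θ n) t)) Filter.atTop (nhds (hat k (v t))) := by
  obtain ⟨θ, f, hθ, hfL, hf⟩ := exists_subseq_tendsto_of_lipschitz (R := ‖v₀‖)
    (L := fun k : Fin 3 → ℤ => (⟨C * ∑ j, |(k j : ℝ)|, by positivity⟩ : NNReal))
    (a := fun n k (t : Icc 0 T) => hat k (w n t))
    (fun n k t => (norm_hat_le _ _).trans_eq ((hw n).norm_eq t t.2))
    (fun n k => LipschitzWith.of_dist_le_mul fun t s => by
      rw [dist_eq_norm]
      exact (hw n).norm_hat_sub_le hC k s.2 t.2)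
  have hsum : ∀ t (s : Finset (Fin 3 → ℤ)), ∑ k ∈ s, ‖f k t‖ ^ 2 ≤ ‖v₀‖ ^ 2 := by
    intro t s
    refine le_of_tendsto (tendsto_finsetSum s fun k _ => ((hf k t).norm.pow 2))
      (Filter.Eventually.of_forall fun n => ?_)
    rw [← (hw (θ n)).norm_eq t t.2]
    exact sum_le_hasSum _ (fun _ _ => sq_nonneg _) (hasSum_norm_hat_sq _)
  have hex : ∀ t : Icc 0 T, ∃ v : L2, ∀ k, hat k v = f k t := fun t =>
    exists_hat_eq (summable_of_sum_le (fun _ => sq_nonneg _) (hsum t))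
  choose V hV using hex
  have hproj : ∀ t, ∀ ht : t ∈ Icc 0 T, projIcc 0 T hT.le t = ⟨t, ht⟩ := fun t ht =>
    projIcc_of_mem hT.le ht
  refine ⟨θ, fun t => V (projIcc 0 T hT.le t), hθ, fun t => ?_, fun t => ?_, fun k => ?_,
    fun t ht k => ?_⟩
  · refine (sq_le_sq₀ (norm_nonneg _) (norm_nonneg _)).1 ?_
    refine hasSum_le_of_sum_le (hasSum_norm_hat_sq _) fun s => ?_
    simp_rw [hV]
    exact hsum _ s
  · refine mem_H_iff.2 fun k => ?_
    rw [hV]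
    have h1 := hf k (projIcc 0 T hT.le t)
    refine tendsto_nhds_unique (((leray k).continuous.tendsto _).comp h1) (h1.congr fun n => ?_)
    exact (mem_H_iff.1 ((hw (θ n)).mem_H _ (projIcc 0 T hT.le t).2) k).symm
  · simp_rw [hV]
    exact (hfL k).continuous.comp continuous_projIcc
  · rw [hV, hproj t ht]
    exact hf k ⟨t, ht⟩

/-- A bounded curve in `H` with continuous Fourier coefficients is strongly measurable. -/
lemma aestronglyMeasurable_of_continuous_hat {v : ℝ → H} (h : ∀ k, Continuous fun t => hat k (v t))
    (μ : Measure ℝ) : AEStronglyMeasurable v μ := by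
  rw [← Topology.IsEmbedding.subtypeVal.aestronglyMeasurable_comp_iff]
  refine aestronglyMeasurable_of_tendsto_ae Filter.atTop
    (f := fun n t => ∑ k ∈ modes n, mode k (hat k (v t : L2))) (fun n => ?_)
    (Filter.Eventually.of_forall fun t => (hasSum_mode_hat _).comp tendsto_modes)
  exact (continuous_finsetSum _ fun k _ => (mode k).continuous.comp (h k)).aestronglyMeasurable

lemma toVDual_apply (h : H) (w : V) : toVDual h w = ⟪(h : L2), w.1.fst⟫ := rfl

lemma sum_norm_snd_le (w : V) : ∑ j, ‖w.1.snd j‖ ≤ 3 * ‖w‖ := by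
  have h : ∀ j, ‖w.1.snd j‖ ≤ ‖w‖ := fun j =>
    (PiLp.norm_apply_le _ j).trans (WithLp.norm_snd_le (x := w.1))
  refine (Finset.sum_le_sum fun j _ => h j).trans_eq ?_
  simp

lemma exists_filtered {α : ℝ} (hα : 0 < α) {v : L2} (hv : v ∈ H) :
    ∃ u : L2, ∀ k, hat k u = filterLeray α k (hat k v) := by
  refine exists_hat_eq (Summable.of_nonneg_of_le (fun _ => sq_nonneg _) (fun k => ?_)
    (hasSum_norm_hat_sq v).summable)
  rw [filterLeray_apply, mem_H_iff.1 hv k, norm_smul,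
    Real.norm_of_nonneg (filterSymbol_nonneg hα k)]
  exact pow_le_pow_left₀ (mul_nonneg (filterSymbol_nonneg hα k) (norm_nonneg _))
    (mul_le_of_le_one_left (norm_nonneg _) (filterSymbol_le_one hα k)) 2

lemma isFiltered_of_hat_eq_filterLeray {α : ℝ} (hα : 0 < α) {v u : L2} (hv : v ∈ H)
    (h : ∀ k, hat k u = filterLeray α k (hat k v)) : IsFiltered α v u := by
  refine isFiltered_of_hat fun k => ?_
  have h0 : (1 + α * ‖freq k‖ ^ 2) ≠ 0 := by positivity
  rw [h k, filterLeray_apply, mem_H_iff.1 hv k, smul_smul, filterSymbol, mul_inv_cancel₀ h0,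
    one_smul]

/-- The limit of the Galerkin approximations is a weak solution. -/
theorem exists_isWeakSolution {α T : ℝ} (hα : 0 < α) (hT : 0 < T) (v₀ : H) :
    ∃ v u : ℝ → H, IsWeakSolution α T v₀ v u := by
  obtain ⟨C, hC0, hC⟩ := exists_isApproxSolution hα hT.le v₀.2
  choose w hw using hC
  obtain ⟨θ, v, hθ, hvR, hvH, hvc, hlim⟩ := exists_limit hT hC0 hw
  choose u hu using fun t => exists_filtered hα (hvH t)
  have huH : ∀ t, u t ∈ H := fun t => mem_H_iff.2 fun k => by
    rw [hu, filterLeray_apply, map_smul, leray_leray]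
  have hwR : ∀ t ∈ Icc 0 T, ∀ n, ‖w (θ n) t‖ ≤ ‖(v₀ : L2)‖ := fun t ht n =>
    ((hw (θ n)).norm_eq t ht).le
  have hweak : ∀ t ∈ Icc 0 T, ∀ x, Filter.Tendsto (fun n => ⟪w (θ n) t, x⟫) Filter.atTop
      (nhds ⟪v t, x⟫) := fun t ht x => tendsto_inner_of_hat (hwR t ht) (hlim t ht) x
  have hgal : ∀ φ, ∀ hφ : IsTestField φ, ∀ s ∈ Icc 0 T, Filter.Tendsto
      (fun n => ⟪galerkin α (θ n) (w (θ n) s) (w (θ n) s), toL2 φ hφ.contDiff.continuous⟫)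
      Filter.atTop (nhds (transport (u s) (v s) φ)) := fun φ hφ s hs =>
    tendsto_inner_galerkin hα hθ.tendsto_atTop (hwR s hs) (hvH s) (hlim s hs) (hu s) hφ
  have hgm : ∀ x, ∀ n, ContinuousOn (fun s => ⟪galerkin α (θ n) (w (θ n) s) (w (θ n) s), x⟫)
      (Icc 0 T) := fun x n =>
    (((galerkin α (θ n)).continuous.comp_continuousOn (hw _).continuousOn).clm_apply
      (hw _).continuousOn).inner continuousOn_const
  have hgb : ∀ φ, ∀ hφ : IsTestField φ, ∀ n, ∀ s ∈ Icc 0 T,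
      ‖⟪galerkin α (θ n) (w (θ n) s) (w (θ n) s), toL2 φ hφ.contDiff.continuous⟫‖
        ≤ C * ∑ j, ‖partialL2 φ hφ.contDiff j‖ := fun φ hφ n s hs =>
    (hw (θ n)).abs_galerkin_le _ _ (fun j => isWeakPartial_toL2 hφ.contDiff hφ.periodic j) s hs
  refine ⟨fun t => ⟨v t, hvH t⟩, fun t => ⟨u t, huH t⟩, ⟨?_, ?_, fun t _ => ?_, fun φ hφ => ?_,
    fun φ hφ t ht => ?_⟩⟩
  · have hm : AEStronglyMeasurable (fun t => (⟨v t, hvH t⟩ : H)) (volume.restrict (Icc 0 T)) :=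
      aestronglyMeasurable_of_continuous_hat (v := fun t => ⟨v t, hvH t⟩) hvc _
    refine MemLp.of_bound hm ‖(v₀ : L2)‖ (Filter.Eventually.of_forall fun t => ?_)
    rw [← Submodule.coe_norm]
    exact hvR t
  -- The uniform bound of the nonlinearities in `V'` makes the limit Lipschitz with values in `V'`.
  · suffices hL : LipschitzOnWith ⟨3 * C, by positivity⟩
        (fun t => toVDual ⟨v t, hvH t⟩) (Icc 0 T) from hL.continuousOn
    refine LipschitzOnWith.of_dist_le_mul fun t ht s hs => ?_
    rw [dist_eq_norm, Real.dist_eq]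
    refine ContinuousLinearMap.opNorm_le_bound _
      (mul_nonneg (NNReal.coe_nonneg _) (abs_nonneg _)) fun x => ?_
    have h1 : (toVDual ⟨v t, hvH t⟩ - toVDual ⟨v s, hvH s⟩) x = ⟪v t - v s, x.1.fst⟫ := by
      rw [sub_apply, toVDual_apply, toVDual_apply, inner_sub_left]
    have h2 : Filter.Tendsto (fun n => ‖⟪w (θ n) t - w (θ n) s, x.1.fst⟫‖) Filter.atTop
        (nhds ‖⟪v t - v s, x.1.fst⟫‖) := by
      simp_rw [inner_sub_left]
      exact ((hweak t ht _).sub (hweak s hs _)).norm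
    rw [h1]
    refine le_of_tendsto h2 (Filter.Eventually.of_forall fun n => ?_)
    refine ((hw (θ n)).abs_sub_le _ _ x.2.2 s hs t ht).trans ?_
    calc C * (∑ j, ‖x.1.snd j‖) * |t - s| ≤ C * (3 * ‖x‖) * |t - s| := by
          gcongr
          exact sum_norm_snd_le x
      _ = 3 * C * |t - s| * ‖x‖ := by ring
  · exact isFiltered_of_hat_eq_filterLeray hα (hvH t) (hu t)
  · refine Integrable.of_bound (C := C * ∑ j, ‖partialL2 φ hφ.contDiff j‖)
      (aestronglyMeasurable_of_tendsto_ae Filter.atTop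
        (fun n => (hgm (toL2 φ hφ.contDiff.continuous) n).aestronglyMeasurable measurableSet_Icc)
        ((ae_restrict_iff' measurableSet_Icc).2 (Filter.Eventually.of_forall (hgal φ hφ)))) ?_
    refine (ae_restrict_iff' measurableSet_Icc).2 (Filter.Eventually.of_forall fun s hs => ?_)
    exact le_of_tendsto (hgal φ hφ s hs).norm (Filter.Eventually.of_forall fun n => hgb φ hφ n s hs)
  · have hin : ∀ x : L2, ∫ y in box, ⟪x y, φ y⟫ = ⟪x, toL2 φ hφ.contDiff.continuous⟫ := by
      intro x
      rw [real_inner_comm, inner_toL2_left]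
      simp only [real_inner_comm]
    have hsub : Ioc 0 t ⊆ Icc 0 T := fun s hs => ⟨hs.1.le, hs.2.trans ht.2⟩
    have hI : Filter.Tendsto (fun n => ∫ s in (0 : ℝ)..t,
        ⟪galerkin α (θ n) (w (θ n) s) (w (θ n) s), toL2 φ hφ.contDiff.continuous⟫) Filter.atTop
        (nhds (∫ s in (0 : ℝ)..t, transport (u s) (v s) φ)) := by
      refine intervalIntegral.tendsto_integral_filter_of_dominated_convergence
        (fun _ => C * ∑ j, ‖partialL2 φ hφ.contDiff j‖) ?_ ?_ intervalIntegrable_const ?_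
      · refine Filter.Eventually.of_forall fun n => ?_
        rw [uIoc_of_le ht.1]
        exact ((hgm _ n).mono hsub).aestronglyMeasurable measurableSet_Ioc
      · refine Filter.Eventually.of_forall fun n => Filter.Eventually.of_forall fun s hs => ?_
        rw [uIoc_of_le ht.1] at hs
        exact hgb φ hφ n s (hsub hs)
      · refine Filter.Eventually.of_forall fun s hs => ?_
        rw [uIoc_of_le ht.1] at hs
        exact hgal φ hφ s (hsub hs)
    rw [hin, hin, sub_eq_iff_eq_add]
    refine tendsto_nhds_unique (hweak t ht _) ((hI.const_add _).congr fun n => ?_)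
    exact ((hw (θ n)).inner_eq _ t ht).symm

end LerayAlpha

end

theorem mainTheorem8 (α : ℝ) (hα : 0 < α) (T : ℝ) (hT : 0 < T) (v₀ : LerayAlpha.H) :
    ∃ v u : ℝ → LerayAlpha.H, LerayAlpha.IsWeakSolution α T v₀ v u :=
  LerayAlpha.exists_isWeakSolution hα hT v₀
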